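/- For $f:\{0,1\}^n\to\{0,1\}$ and $x\in\{0,1\}^n$, a certificate for $f$'s value at $x$ is a set $S\subseteq[n]$ such that $f(y)=f(x)$ for every $y\in\{0,1\}^n$ that agrees with $x$ on $S$. Let $\mathrm{Cert}(f,x)$ be the size of a smallest certificate for $f$'s value at $x$, and $\mathrm{Cert}(f)=\max_{x\in\{0,1\}^n}\mathrm{Cert}(f,x)$. There is a randomized algorithm with access to an oracle for a language in $\mathsf{NP}$, a polynomial $p$, an absolute constant $K$, and a function $\varepsilon:\mathbb N\to\mathbb R$ with $\varepsilon(n)\le n^{-\omega(1)}$ such that the following holds for every $n$, every Boolean circuit computing a function $f:\{0,1\}^n\to\{0,1\}$ with $s$ gates, and every $x^\star\in\{0,1\}^n$. Given only the circuit and $x^\star$ (in particular, not the value $\mathrm{Cert}(f)$), the algorithm halts within $p(n+s)$ steps for every outcome of its coin tosses (hence in time $\mathrm{poly}(n)$ on circuits of size $\mathrm{poly}(n)$), and with probability at least $1-\varepsilon(n)$ it outputs a certificate $S\subseteq[n]$ for $f$'s value at $x^\star$ with $|S|\le K\cdot\mathrm{Cert}(f)^5$. -/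

import Mathlib

/-! ### Machine model: randomized oracle machines working on finitely many stacks of bits -/

/-- Programs of a multi-stack machine over the alphabet `{0,1}`. A program mentions only finitely
many of the stacks, which are numbered by `ℕ`. Each instruction looks at, removes or adds a single
bit on top of a stack, so one step is one step of a multi-tape Turing machine (a stack is a one-sided
tape, two stacks form a two-sided one); `flip` tosses a fair coin, and `query` is the usual oracle
call, answered in one step. -/
inductive Prog : Type
  | skip : Prog
  /-- push the bit `b` on stack `r` -/
  | push (r : ℕ) (b : Bool) : Prog
  /-- remove the top bit of stack `r` (no effect on an empty stack) -/
  | pop (r : ℕ) : Prog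
  /-- push a fair random bit on stack `r` -/
  | flip (r : ℕ) : Prog
  /-- ask whether the content of stack `q` belongs to the oracle; push the answer on stack `a` -/
  | query (q a : ℕ) : Prog
  | seq (P Q : Prog) : Prog
  /-- continue with `E`, `P₀`, `P₁` if stack `r` is empty, has top bit `0`, has top bit `1` -/
  | branch (r : ℕ) (E P₀ P₁ : Prog) : Prog
  /-- repeat `P` as long as stack `r` is nonempty -/
  | loop (r : ℕ) (P : Prog) : Prog

/-- No coin tosses and no oracle calls. -/
def Prog.IsDeterministic : Prog → Prop
  | .skip => True
  | .push _ _ => True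
  | .pop _ => True
  | .flip _ => False
  | .query _ _ => False
  | .seq P Q => P.IsDeterministic ∧ Q.IsDeterministic
  | .branch _ E P₀ P₁ => E.IsDeterministic ∧ P₀.IsDeterministic ∧ P₁.IsDeterministic
  | .loop _ P => P.IsDeterministic

/-- Contents of the stacks; the head of the list is the top of the stack. -/
abbrev Store : Type := ℕ → List Bool

/-- A configuration: what remains to be executed (the program counter), and the stacks. -/
structure Config : Type where
  todo : List Prog
  store : Store

/-- One step of the machine with oracle `O`, where `c` is the coin of this step (it matters only if
the instruction is `flip`). A configuration with nothing left to execute has halted and stays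
as it is. -/
noncomputable def step (O : Language Bool) (c : Bool) : Config → Config
  | ⟨[], σ⟩ => ⟨[], σ⟩
  | ⟨.skip :: k, σ⟩ => ⟨k, σ⟩
  | ⟨.push r b :: k, σ⟩ => ⟨k, Function.update σ r (b :: σ r)⟩
  | ⟨.pop r :: k, σ⟩ => ⟨k, Function.update σ r (σ r).tail⟩
  | ⟨.flip r :: k, σ⟩ => ⟨k, Function.update σ r (c :: σ r)⟩
  | ⟨.query q a :: k, σ⟩ =>
      ⟨k, Function.update σ a (@decide (σ q ∈ O) (Classical.propDecidable _) :: σ a)⟩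
  | ⟨.seq P Q :: k, σ⟩ => ⟨P :: Q :: k, σ⟩
  | ⟨.branch r E P₀ P₁ :: k, σ⟩ =>
      match σ r with
      | [] => ⟨E :: k, σ⟩
      | false :: _ => ⟨P₀ :: k, σ⟩
      | true :: _ => ⟨P₁ :: k, σ⟩
  | ⟨.loop r P :: k, σ⟩ =>
      match σ r with
      | [] => ⟨k, σ⟩
      | _ :: _ => ⟨P :: .loop r P :: k, σ⟩

/-- The configuration reached after `coins.length` steps, with the given coins. -/
noncomputable def run (O : Language Bool) (P : Prog) (σ : Store) (coins : List Bool) : Config :=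
  coins.foldl (fun γ c => step O c γ) ⟨[P], σ⟩

/-- The initial stacks on a pair of input strings: stack `0` holds the first one, stack `1` the
second one, and all other stacks are empty. -/
def inputStore (u v : List Bool) : Store
  | 0 => u
  | 1 => v
  | _ + 2 => []

/-- On input `(u, v)` the program halts within `T` steps, whatever the coins are. -/
def HaltsWithin (O : Language Bool) (P : Prog) (u v : List Bool) (T : ℕ) : Prop :=
  ∀ coins : List Bool, coins.length = T → (run O P (inputStore u v) coins).todo = []

/-- The probability, over `T` independent fair coins, that on input `(u, v)` the program has halted
after `T` steps with an output in `A`. The output is the content of stack `0`. -/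
noncomputable def outputProb (O : Language Bool) (P : Prog) (u v : List Bool) (T : ℕ)
    (A : Set (List Bool)) : ℝ :=
  (Nat.card {r : Fin T → Bool // (run O P (inputStore u v) (List.ofFn r)).todo = [] ∧
    (run O P (inputStore u v) (List.ofFn r)).store 0 ∈ A} : ℝ) / 2 ^ T

/-- The class NP: membership has witnesses of polynomial length that are checked by a deterministic
polynomial-time program (without oracle). The program accepts by halting with output `1`. -/
def InNP (L : Language Bool) : Prop :=
  ∃ (V : Prog) (p q : Polynomial ℕ), V.IsDeterministic ∧
    (∀ x w : List Bool, HaltsWithin 0 V x w (p.eval (x.length + w.length))) ∧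
    ∀ x : List Bool, x ∈ L ↔ ∃ w : List Bool, w.length ≤ q.eval x.length ∧
      (run 0 V (inputStore x w)
        (List.replicate (p.eval (x.length + w.length)) false)).store 0 = [true]

/-! ### Boolean circuits -/

/-- Gates; the arguments are numbers of wires. -/
inductive Gate : Type
  | const (b : Bool) : Gate
  | not (i : ℕ) : Gate
  | and (i j : ℕ) : Gate
  | or (i j : ℕ) : Gate

/-- All arguments of the gate are among the wires `0, …, m - 1`. -/
def Gate.ArgsLt (m : ℕ) : Gate → Prop
  | .const _ => True
  | .not i => i < m
  | .and i j => i < m ∧ j < m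
  | .or i j => i < m ∧ j < m

def Gate.eval (wires : List Bool) : Gate → Bool
  | .const b => b
  | .not i => !(wires.getD i false)
  | .and i j => wires.getD i false && wires.getD j false
  | .or i j => wires.getD i false || wires.getD j false

/-- Boolean circuits with `n` inputs. Wires `0, …, n - 1` are the inputs, wire `n + k` is the output
of the `k`-th gate, and gates read earlier wires only. -/
structure Circuit (n : ℕ) : Type where
  gates : List Gate
  out : ℕ
  argsLt : ∀ (k : ℕ) (hk : k < gates.length), gates[k].ArgsLt (n + k)
  outLt : out < n + gates.length

namespace Circuit

def size {n : ℕ} (C : Circuit n) : ℕ := C.gates.length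

/-- The Boolean function computed by the circuit. -/
def eval {n : ℕ} (C : Circuit n) (x : Fin n → Bool) : Bool :=
  (C.gates.foldl (fun wires g => wires ++ [g.eval wires]) (List.ofFn x)).getD C.out false

end Circuit

/-! ### Encoding by bit strings -/

/-- `1ᵏ0` -/
def encodeNat (k : ℕ) : List Bool := List.replicate k true ++ [false]

def Gate.encode : Gate → List Bool
  | .const b => [false, false, b]
  | .not i => [false, true] ++ encodeNat i
  | .and i j => [true, false] ++ encodeNat i ++ encodeNat j
  | .or i j => [true, true] ++ encodeNat i ++ encodeNat j

/-- The number of inputs, the gates (each announced by a `1`, the end of the list by a `0`), and the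
output wire. The length is polynomial in `n + C.size`, since wire numbers are below `n + C.size`. -/
def Circuit.encode {n : ℕ} (C : Circuit n) : List Bool :=
  encodeNat n ++ C.gates.flatMap (fun g => true :: g.encode) ++ [false] ++ encodeNat C.out

/-- A set of coordinates as its characteristic string. -/
def encodeSet {n : ℕ} (S : Finset (Fin n)) : List Bool :=
  List.ofFn fun i => decide (i ∈ S)

/-! ### Certificates -/

/-- `S` is a certificate for the value of `f` at `x`. -/
def IsCertificate {n : ℕ} (f : (Fin n → Bool) → Bool) (x : Fin n → Bool) (S : Finset (Fin n)) :
    Prop :=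
  ∀ y : Fin n → Bool, (∀ i ∈ S, y i = x i) → f x = f y

/-- The size of a smallest certificate for the value of `f` at `x`. -/
noncomputable def certAt {n : ℕ} (f : (Fin n → Bool) → Bool) (x : Fin n → Bool) : ℕ :=
  sInf {k | ∃ S : Finset (Fin n), IsCertificate f x S ∧ S.card = k}

/-- The certificate complexity of `f`. -/
noncomputable def certComplexity {n : ℕ} (f : (Fin n → Bool) → Bool) : ℕ :=
  Finset.univ.sup (certAt f)

/-! The bound holds with exponent 2, and the algorithm is deterministic. Write c for Cert(f) and
grow a set U from the empty set. While U is not a certificate at x, some z agrees with x on U and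
has f z ≠ f x. Fix the coordinates of z one after the other, asking an NP oracle each time whether
agreement with x is still possible and flipping only when it is not (`greedy`). Let B be the set
where the final z differs from x.

B is small: flipping z back at any i in B changes f, for otherwise the query at i would have been
answered yes. So every certificate at z contains B, and |B| ≤ c. B is also useful: z agrees with x
off B, so B meets every certificate at x (`block_greedy_spec`). Now fix a smallest certificate S at
x. Adding the disjoint blocks B to U preserves |U| ≤ c·|U ∩ S| (`nextSet_card_le`), hence |U| ≤
c·|S| ≤ c². Each block is nonempty, so n rounds suffice. The value f x need not be known: a round
whose target is f x itself changes nothing (`nextSet_self`), so both targets are tried.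

The remaining work is the machine. `den` gives the effect of a program on the stacks and `Exec` ties
it to actual runs. `Tame` and `PolyTime` bound time and space compositionally, and symbolic
execution of the verifier and of one round (`den_verifier`, `den_round`) identifies the programs
with the mathematical objects above. -/

namespace Certification

/-! ### Denotation of programs and its relation to runs -/

open Classical in
/-- Iterate `F` until stack `r` is empty; the constant empty store if this never happens. -/
noncomputable def whileNonempty (r : ℕ) (F : Store → Store) (σ : Store) : Store :=
  if h : ∃ m, (F^[m] σ) r = [] then F^[Nat.find h] σ else fun _ => []

theorem whileNonempty_nil {r : ℕ} {F : Store → Store} {σ : Store} (h : σ r = []) :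
    whileNonempty r F σ = σ := by
  classical
  have hex : ∃ m, (F^[m] σ) r = [] := ⟨0, h⟩
  have h0 : Nat.find hex = 0 := (Nat.find_eq_zero hex).2 h
  rw [whileNonempty, dif_pos hex, h0, Function.iterate_zero, id]

/-- No termination hypothesis is needed: if the iteration from `σ` never empties the stack, neither
does the one from `F σ`, and both sides are the default store. -/
theorem whileNonempty_cons {r : ℕ} {F : Store → Store} {σ : Store} (h : σ r ≠ []) :
    whileNonempty r F σ = whileNonempty r F (F σ) := by
  classical
  by_cases hex : ∃ m, (F^[m] (F σ)) r = []
  · have hex' : ∃ m, (F^[m] σ) r = [] := hex.imp' Nat.succ fun m hm => hm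
    have hf : Nat.find hex' = Nat.find hex + 1 := Nat.find_comp_succ hex' hex h
    rw [whileNonempty, whileNonempty, dif_pos hex, dif_pos hex', hf, Function.iterate_succ_apply]
  · have hex' : ¬ ∃ m, (F^[m] σ) r = [] := by
      rintro ⟨_ | m, hm⟩
      · exact h hm
      · exact hex ⟨m, hm⟩
    rw [whileNonempty, whileNonempty, dif_neg hex, dif_neg hex']

/-- The effect of a program without coin tosses on the stacks, provided that it halts. -/
noncomputable def den (O : Language Bool) : Prog → Store → Store
  | .skip, σ => σ
  | .push r b, σ => Function.update σ r (b :: σ r)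
  | .pop r, σ => Function.update σ r (σ r).tail
  | .flip _, σ => σ
  | .query q a, σ =>
      Function.update σ a (@decide (σ q ∈ O) (Classical.propDecidable _) :: σ a)
  | .seq P Q, σ => den O Q (den O P σ)
  | .branch r E P₀ P₁, σ =>
      match σ r with
      | [] => den O E σ
      | false :: _ => den O P₀ σ
      | true :: _ => den O P₁ σ
  | .loop r P, σ => whileNonempty r (den O P) σ

variable {O : Language Bool}

theorem den_branch_nil {r : ℕ} {E P₀ P₁ : Prog} {σ : Store} (h : σ r = []) :
    den O (.branch r E P₀ P₁) σ = den O E σ := by simp [den, h]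

theorem den_branch_false {r : ℕ} {E P₀ P₁ : Prog} {σ : Store} {l : List Bool}
    (h : σ r = false :: l) : den O (.branch r E P₀ P₁) σ = den O P₀ σ := by simp [den, h]

theorem den_branch_true {r : ℕ} {E P₀ P₁ : Prog} {σ : Store} {l : List Bool}
    (h : σ r = true :: l) : den O (.branch r E P₀ P₁) σ = den O P₁ σ := by simp [den, h]

theorem den_loop_nil {r : ℕ} {P : Prog} {σ : Store} (h : σ r = []) :
    den O (.loop r P) σ = σ := whileNonempty_nil h

theorem den_loop_cons {r : ℕ} {P : Prog} {σ : Store} (h : σ r ≠ []) :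
    den O (.loop r P) σ = den O (.loop r P) (den O P σ) := whileNonempty_cons h

/-- From `σ` the program `P` comes to its end after exactly `t` steps, with stacks `σ'`, whatever
the coins are and whatever remains to be executed afterwards. -/
def Exec (O : Language Bool) (P : Prog) (σ σ' : Store) (t : ℕ) : Prop :=
  ∀ (k : List Prog) (coins : List Bool), coins.length = t →
    coins.foldl (fun γ c => step O c γ) ⟨P :: k, σ⟩ = ⟨k, σ'⟩

theorem Exec.of_step {P : Prog} {σ σ' : Store}
    (h : ∀ k c, step O c ⟨P :: k, σ⟩ = ⟨k, σ'⟩) : Exec O P σ σ' 1 := by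
  intro k coins hc
  obtain ⟨c, rfl⟩ := List.length_eq_one_iff.1 hc
  exact h k c

theorem exec_skip (σ : Store) : Exec O .skip σ (den O .skip σ) 1 := .of_step fun _ _ => rfl

theorem exec_push (r : ℕ) (b : Bool) (σ : Store) :
    Exec O (.push r b) σ (den O (.push r b) σ) 1 := .of_step fun _ _ => rfl

theorem exec_pop (r : ℕ) (σ : Store) : Exec O (.pop r) σ (den O (.pop r) σ) 1 :=
  .of_step fun _ _ => rfl

theorem exec_query (q a : ℕ) (σ : Store) :
    Exec O (.query q a) σ (den O (.query q a) σ) 1 := .of_step fun _ _ => rfl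

theorem Exec.step_left {P Q : Prog} {σ σ' : Store} {t : ℕ}
    (h : ∀ k c, step O c ⟨P :: k, σ⟩ = ⟨Q :: k, σ⟩) (hQ : Exec O Q σ σ' t) :
    Exec O P σ σ' (t + 1) := by
  intro k coins hc
  obtain ⟨c, coins, rfl⟩ := List.exists_cons_of_length_eq_add_one hc
  rw [List.foldl_cons, h]
  exact hQ k coins (by simpa using hc)

theorem Exec.step_left₂ {P Q R : Prog} {σ σ₁ σ₂ : Store} {t₁ t₂ : ℕ}
    (h : ∀ k c, step O c ⟨P :: k, σ⟩ = ⟨Q :: R :: k, σ⟩) (hQ : Exec O Q σ σ₁ t₁)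
    (hR : Exec O R σ₁ σ₂ t₂) : Exec O P σ σ₂ (t₁ + t₂ + 1) := by
  intro k coins hc
  obtain ⟨c, coins, rfl⟩ := List.exists_cons_of_length_eq_add_one hc
  have hl : coins.length = t₁ + t₂ := by simpa using hc
  rw [List.foldl_cons, h, ← List.take_append_drop t₁ coins, List.foldl_append,
    hQ _ _ (by simp [hl]), hR _ _ (by simp [hl])]

theorem Exec.seq {P Q : Prog} {σ σ₁ σ₂ : Store} {t₁ t₂ : ℕ} (hP : Exec O P σ σ₁ t₁)
    (hQ : Exec O Q σ₁ σ₂ t₂) : Exec O (.seq P Q) σ σ₂ (t₁ + t₂ + 1) :=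
  .step_left₂ (fun _ _ => rfl) hP hQ

theorem Exec.loop_nil {r : ℕ} {P : Prog} {σ : Store} (h : σ r = []) :
    Exec O (.loop r P) σ σ 1 := .of_step fun k c => by simp [step, h]

theorem Exec.loop_cons {r : ℕ} {P : Prog} {σ σ₁ σ₂ : Store} {t₁ t₂ : ℕ} (h : σ r ≠ [])
    (hP : Exec O P σ σ₁ t₁) (hL : Exec O (.loop r P) σ₁ σ₂ t₂) :
    Exec O (.loop r P) σ σ₂ (t₁ + t₂ + 1) := by
  obtain ⟨b, l, h⟩ := List.exists_cons_of_ne_nil h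
  exact .step_left₂ (fun k c => by simp [step, h]) hP hL

theorem exec_branch {r : ℕ} {E P₀ P₁ : Prog} {σ : Store} {tE t₀ t₁ : ℕ}
    (hE : Exec O E σ (den O E σ) tE) (h₀ : Exec O P₀ σ (den O P₀ σ) t₀)
    (h₁ : Exec O P₁ σ (den O P₁ σ) t₁) :
    ∃ t ≤ tE + t₀ + t₁ + 1,
      Exec O (.branch r E P₀ P₁) σ (den O (.branch r E P₀ P₁) σ) t := by
  rcases h : σ r with _ | ⟨_ | _, l⟩
  · rw [den_branch_nil h]
    exact ⟨_, by lia, .step_left (fun k c => by simp [step, h]) hE⟩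
  · rw [den_branch_false h]
    exact ⟨_, by lia, .step_left (fun k c => by simp [step, h]) h₀⟩
  · rw [den_branch_true h]
    exact ⟨_, by lia, .step_left (fun k c => by simp [step, h]) h₁⟩

theorem foldl_step_halted (σ : Store) (coins : List Bool) :
    coins.foldl (fun γ c => step O c γ) ⟨[], σ⟩ = ⟨[], σ⟩ := by
  induction coins with
  | nil => rfl
  | cons c l ih => exact ih

theorem Exec.run_eq {P : Prog} {σ σ' : Store} {t : ℕ} (h : Exec O P σ σ' t) {coins : List Bool}
    (hc : t ≤ coins.length) : run O P σ coins = ⟨[], σ'⟩ := by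
  rw [run, ← List.take_append_drop t coins, List.foldl_append, h [] _ (by simpa using hc),
    foldl_step_halted]

/-! ### Time and space bounds -/

/-- The program has no instruction that adds a bit to stack `r`. -/
def NoPush (r : ℕ) : Prog → Prop
  | .skip => True
  | .push s _ => s ≠ r
  | .pop _ => True
  | .flip s => s ≠ r
  | .query _ a => a ≠ r
  | .seq P Q => NoPush r P ∧ NoPush r Q
  | .branch _ E P₀ P₁ => NoPush r E ∧ NoPush r P₀ ∧ NoPush r P₁
  | .loop _ P => NoPush r P

/-- Serves the termination measures: a loop body that never pushes on the stack being consumed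
cannot undo the progress made by a pop. -/
theorem NoPush.length_den_le {r : ℕ} : ∀ {P : Prog}, NoPush r P → ∀ σ : Store,
    (den O P σ r).length ≤ (σ r).length
  | .skip, _, _ => le_rfl
  | .push s b, h, σ => by simp [den, Function.update_of_ne (Ne.symm h)]
  | .pop s, _, σ => by
      by_cases hs : r = s
      · subst hs; simp [den]
      · simp [den, Function.update_of_ne hs]
  | .flip _, _, _ => le_rfl
  | .query q a, h, σ => by simp [den, Function.update_of_ne (Ne.symm h)]
  | .seq P Q, h, σ => (length_den_le h.2 _).trans (length_den_le h.1 σ)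
  | .branch s E P₀ P₁, h, σ => by
      rcases hs : σ s with _ | ⟨_ | _, l⟩
      · rw [den_branch_nil hs]; exact length_den_le h.1 σ
      · rw [den_branch_false hs]; exact length_den_le h.2.1 σ
      · rw [den_branch_true hs]; exact length_den_le h.2.2 σ
  | .loop s P, h, σ => by
      have hi : ∀ m (τ : Store), ((den O P)^[m] τ r).length ≤ (τ r).length := by
        intro m
        induction m with
        | zero => exact fun _ => le_rfl
        | succ m ih => exact fun τ => (ih _).trans (length_den_le (P := P) h τ)
      rw [den, whileNonempty]
      -- The default value of a diverging loop is the empty store, so the bound survives in that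
      -- case too.
      split_ifs
      · exact hi _ σ
      · simp

/-- The total number of bits on the stacks `0, …, 11`. -/
def size (σ : Store) : ℕ := ∑ r ∈ Finset.range 12, (σ r).length

theorem size_update (σ : Store) {r : ℕ} (hr : r < 12) (l : List Bool) :
    size (Function.update σ r l) + (σ r).length = size σ + l.length := by
  have hr' : r ∈ Finset.range 12 := Finset.mem_range.2 hr
  have h := Finset.add_sum_erase (Finset.range 12) (fun s => (Function.update σ r l s).length) hr'
  have h' := Finset.add_sum_erase (Finset.range 12) (fun s => (σ s).length) hr'
  have he : ∑ s ∈ (Finset.range 12).erase r, (Function.update σ r l s).length =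
      ∑ s ∈ (Finset.range 12).erase r, (σ s).length :=
    Finset.sum_congr rfl fun s hs => by rw [Function.update_of_ne (Finset.ne_of_mem_erase hs)]
  simp only [Function.update_self] at h
  unfold size
  lia

theorem length_le_size (σ : Store) {r : ℕ} (hr : r < 12) : (σ r).length ≤ size σ :=
  Finset.single_le_sum (f := fun s => (σ s).length) (fun _ _ => Nat.zero_le _)
    (Finset.mem_range.2 hr)

theorem length_add_length_le_size (σ : Store) {r s : ℕ} (hr : r < 12) (hs : s < 12) (h : r ≠ s) :
    (σ r).length + (σ s).length ≤ size σ := by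
  have := Finset.sum_le_sum_of_subset (f := fun s => (σ s).length)
    (show ({r, s} : Finset ℕ) ⊆ Finset.range 12 by
      intro a; simp only [Finset.mem_insert, Finset.mem_singleton, Finset.mem_range]; lia)
  rwa [Finset.sum_pair h] at this

theorem eval_mono (T : Polynomial ℕ) {a b : ℕ} (h : a ≤ b) : T.eval a ≤ T.eval b := by
  rw [Polynomial.eval_eq_sum_range, Polynomial.eval_eq_sum_range]
  gcongr

/-- `P` halts in time polynomial in the size of the stacks, and adds at most `g` bits to them. -/
def Tame (O : Language Bool) (P : Prog) (g : ℕ) : Prop :=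
  ∃ T : Polynomial ℕ, ∀ σ, size (den O P σ) ≤ size σ + g ∧
    ∃ t ≤ T.eval (size σ), Exec O P σ (den O P σ) t

/-- `P` halts in time polynomial in the size of the stacks, with stacks of polynomial size. -/
def PolyTime (O : Language Bool) (P : Prog) : Prop :=
  ∃ T G : Polynomial ℕ, ∀ σ, size (den O P σ) ≤ G.eval (size σ) ∧
    ∃ t ≤ T.eval (size σ), Exec O P σ (den O P σ) t

theorem Tame.polyTime {P : Prog} {g : ℕ} (h : Tame O P g) : PolyTime O P := by
  obtain ⟨T, hT⟩ := h
  exact ⟨T, .X + .C g, fun σ => by simpa using hT σ⟩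

theorem Tame.mono {P : Prog} {g g' : ℕ} (h : Tame O P g) (hg : g ≤ g') : Tame O P g' := by
  obtain ⟨T, hT⟩ := h
  exact ⟨T, fun σ => ⟨(hT σ).1.trans (by lia), (hT σ).2⟩⟩

theorem tame_skip : Tame O .skip 0 := ⟨1, fun σ => ⟨le_rfl, 1, by simp, exec_skip σ⟩⟩

theorem tame_push {r : ℕ} (hr : r < 12) (b : Bool) : Tame O (.push r b) 1 :=
  ⟨1, fun σ => ⟨by
    have := size_update σ hr (b :: σ r)
    simp only [List.length_cons] at this
    change size (Function.update σ r (b :: σ r)) ≤ _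
    lia, 1, by simp, exec_push r b σ⟩⟩

theorem tame_pop {r : ℕ} (hr : r < 12) : Tame O (.pop r) 0 :=
  ⟨1, fun σ => ⟨by
    have := size_update σ hr (σ r).tail
    simp only [List.length_tail] at this
    change size (Function.update σ r (σ r).tail) ≤ _
    lia, 1, by simp, exec_pop r σ⟩⟩

theorem tame_query (q : ℕ) {a : ℕ} (ha : a < 12) : Tame O (.query q a) 1 :=
  ⟨1, fun σ => ⟨by
    have := size_update σ ha (@decide (σ q ∈ O) (Classical.propDecidable _) :: σ a)
    simp only [List.length_cons] at this
    change size (Function.update σ a _) ≤ _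
    lia, 1, by simp, exec_query q a σ⟩⟩

theorem PolyTime.seq {P Q : Prog} (hP : PolyTime O P) (hQ : PolyTime O Q) :
    PolyTime O (.seq P Q) := by
  obtain ⟨T, G, h⟩ := hP
  obtain ⟨T', G', h'⟩ := hQ
  refine ⟨T + T'.comp G + 1, G'.comp G, fun σ => ?_⟩
  obtain ⟨hs, t, ht, he⟩ := h σ
  obtain ⟨hs', t', ht', he'⟩ := h' (den O P σ)
  have h1 := eval_mono T' hs
  have h2 := eval_mono G' hs
  refine ⟨?_, t + t' + 1, ?_, he.seq he'⟩
  · rw [Polynomial.eval_comp]; exact hs'.trans h2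
  · simp only [Polynomial.eval_add, Polynomial.eval_comp, Polynomial.eval_one]; lia

theorem Tame.seq {P Q : Prog} {g g' : ℕ} (hP : Tame O P g) (hQ : Tame O Q g') :
    Tame O (.seq P Q) (g + g') := by
  obtain ⟨T, h⟩ := hP
  obtain ⟨T', h'⟩ := hQ
  refine ⟨T + T'.comp (.X + .C g) + 1, fun σ => ?_⟩
  obtain ⟨hs, t, ht, he⟩ := h σ
  obtain ⟨hs', t', ht', he'⟩ := h' (den O P σ)
  have h1 := eval_mono T' hs
  refine ⟨hs'.trans (by lia), t + t' + 1, ?_, he.seq he'⟩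
  simp only [Polynomial.eval_add, Polynomial.eval_comp, Polynomial.eval_one, Polynomial.eval_X,
    Polynomial.eval_C]
  lia

theorem PolyTime.branch {r : ℕ} {E P₀ P₁ : Prog} (hE : PolyTime O E) (h₀ : PolyTime O P₀)
    (h₁ : PolyTime O P₁) : PolyTime O (.branch r E P₀ P₁) := by
  obtain ⟨T, G, h⟩ := hE
  obtain ⟨T', G', h'⟩ := h₀
  obtain ⟨T'', G'', h''⟩ := h₁
  refine ⟨T + T' + T'' + 1, G + G' + G'', fun σ => ?_⟩
  obtain ⟨hs, t, ht, he⟩ := h σ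
  obtain ⟨hs', t', ht', he'⟩ := h' σ
  obtain ⟨hs'', t'', ht'', he''⟩ := h'' σ
  obtain ⟨u, hu, hx⟩ := exec_branch (r := r) he he' he''
  simp only [Polynomial.eval_add, Polynomial.eval_one]
  refine ⟨?_, u, by lia, hx⟩
  rcases h : σ r with _ | ⟨_ | _, l⟩
  · rw [den_branch_nil h]; lia
  · rw [den_branch_false h]; lia
  · rw [den_branch_true h]; lia

theorem Tame.branch {r : ℕ} {E P₀ P₁ : Prog} {gE g₀ g₁ : ℕ} (hE : Tame O E gE)
    (h₀ : Tame O P₀ g₀) (h₁ : Tame O P₁ g₁) :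
    Tame O (.branch r E P₀ P₁) (max gE (max g₀ g₁)) := by
  obtain ⟨T, h⟩ := hE
  obtain ⟨T', h'⟩ := h₀
  obtain ⟨T'', h''⟩ := h₁
  refine ⟨T + T' + T'' + 1, fun σ => ?_⟩
  obtain ⟨hs, t, ht, he⟩ := h σ
  obtain ⟨hs', t', ht', he'⟩ := h' σ
  obtain ⟨hs'', t'', ht'', he''⟩ := h'' σ
  obtain ⟨u, hu, hx⟩ := exec_branch (r := r) he he' he''
  simp only [Polynomial.eval_add, Polynomial.eval_one]
  refine ⟨?_, u, by lia, hx⟩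
  rcases h : σ r with _ | ⟨_ | _, l⟩
  · rw [den_branch_nil h]; lia
  · rw [den_branch_false h]; lia
  · rw [den_branch_true h]; lia

/-- Every execution of the body `B` of a loop decreases `μ`, and `B` adds at most `g` bits. -/
theorem exec_loop {r g : ℕ} {B : Prog} {T : Polynomial ℕ} (μ : Store → ℕ)
    (hB : ∀ σ, σ r ≠ [] → μ (den O B σ) < μ σ ∧ size (den O B σ) ≤ size σ + g ∧
      ∃ t ≤ T.eval (size σ), Exec O B σ (den O B σ) t) (k : ℕ) (σ : Store) (hk : μ σ ≤ k) :
    size (den O (.loop r B) σ) ≤ size σ + g * k ∧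
      ∃ t ≤ k * (T.eval (size σ + g * k) + 1) + 1,
        Exec O (.loop r B) σ (den O (.loop r B) σ) t := by
  induction k generalizing σ with
  | zero =>
    have h : σ r = [] := by
      by_contra h
      have := (hB σ h).1
      lia
    rw [den_loop_nil h]
    exact ⟨by lia, 1, by lia, .loop_nil h⟩
  | succ k ih =>
    by_cases h : σ r = []
    · rw [den_loop_nil h]
      exact ⟨by lia, 1, by lia, .loop_nil h⟩
    · obtain ⟨hμ, hs, t, ht, he⟩ := hB σ h
      obtain ⟨hs', t', ht', he'⟩ := ih (den O B σ) (by lia)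
      rw [den_loop_cons h]
      -- All intermediate stores have size at most `size σ + g * (k + 1)`, so one value of `T`
      -- bounds the time of every iteration.
      have h1 : T.eval (size (den O B σ) + g * k) ≤ T.eval (size σ + g * (k + 1)) :=
        eval_mono T (by linarith)
      have h2 : T.eval (size σ) ≤ T.eval (size σ + g * (k + 1)) := eval_mono T (by lia)
      have h3 := Nat.mul_le_mul_left k (Nat.add_le_add_right h1 1)
      refine ⟨by linarith, t + t' + 1, ?_, .loop_cons h he he'⟩
      linarith

/-- The body must grow the stacks only additively: a polynomial growth could compound over the
iterations. This is why `Tame` is kept apart from `PolyTime`. -/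
theorem polyTime_loop {r g g' : ℕ} {B : Prog} (μ : Store → ℕ) (hμ : ∀ σ, μ σ ≤ size σ)
    (hB : Tame O B g') (hdec : ∀ σ, σ r ≠ [] → μ (den O B σ) < μ σ ∧
      size (den O B σ) ≤ size σ + g) : PolyTime O (.loop r B) := by
  obtain ⟨T, hT⟩ := hB
  refine ⟨.X * (T.comp (.X + .C g * .X) + 1) + 1, .X + .C g * .X, fun σ => ?_⟩
  have := exec_loop μ (fun σ h => ⟨(hdec σ h).1, (hdec σ h).2, (hT σ).2⟩) (size σ) σ (hμ σ)
  simpa using this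

/-- Without net growth in the body the loop is itself `Tame`, and so may be nested in another loop.
-/
theorem tame_loop {r g' : ℕ} {B : Prog} (μ : Store → ℕ) (hμ : ∀ σ, μ σ ≤ size σ)
    (hB : Tame O B g') (hdec : ∀ σ, σ r ≠ [] → μ (den O B σ) < μ σ ∧
      size (den O B σ) ≤ size σ) : Tame O (.loop r B) 0 := by
  obtain ⟨T, hT⟩ := hB
  refine ⟨.X * (T + 1) + 1, fun σ => ?_⟩
  have := exec_loop (g := 0) μ (fun σ h => ⟨(hdec σ h).1, (hdec σ h).2, (hT σ).2⟩) (size σ) σ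
    (hμ σ)
  simpa using this

theorem size_den_pop {σ : Store} {r : ℕ} (hr : r < 12) (h : σ r ≠ []) :
    size (den O (.pop r) σ) + 1 = size σ := by
  have := size_update σ hr (σ r).tail
  have h' := List.length_pos_iff.2 h
  rw [List.length_tail] at this
  rw [den]
  lia

theorem length_den_pop_self (σ : Store) (r : ℕ) :
    (den O (.pop r) σ r).length = (σ r).length - 1 := by simp [den]

theorem length_den_pop_of_ne (σ : Store) {r s : ℕ} (h : s ≠ r) :
    (den O (.pop r) σ s).length = (σ s).length := by simp [den, Function.update_of_ne h]

/-- Remove the bits of stack `r` one after the other, executing `P₀` or `P₁` for each of them. -/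
def drain (r : ℕ) (P₀ P₁ : Prog) : Prog :=
  .loop r (.branch r .skip (.seq (.pop r) P₀) (.seq (.pop r) P₁))

/-- Remove bits of stack `0` up to the first `0`, executing `P` for each `1`. Stack `F` is used to
leave the loop. -/
def readOnes (F : ℕ) (P : Prog) : Prog :=
  .loop F (.branch 0 (.pop F) (.seq (.pop 0) (.pop F)) (.seq (.pop 0) P))

/-- As `readOnes`, after the preparation of stack `F`. -/
def scan (F : ℕ) (P : Prog) : Prog := .seq (.push F true) (readOnes F P)

/-- Move the top bit of stack `r` to stack `s`. -/
def move (r s : ℕ) : Prog :=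
  .branch r .skip (.seq (.pop r) (.push s false)) (.seq (.pop r) (.push s true))

/-- Move all bits of stack `r` to stack `s`. -/
def moveAll (r s : ℕ) : Prog := drain r (.push s false) (.push s true)

/-- The bit popped pays for one of the `g + 1` bits that the body may push. -/
theorem drain_decreases {r g : ℕ} {P₀ P₁ : Prog} (hr : r < 12) (h₀ : Tame O P₀ (g + 1))
    (h₁ : Tame O P₁ (g + 1)) (n₀ : NoPush r P₀) (n₁ : NoPush r P₁) (σ : Store) (h : σ r ≠ []) :
    (den O (.branch r .skip (.seq (.pop r) P₀) (.seq (.pop r) P₁)) σ r).length < (σ r).length ∧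
    size (den O (.branch r .skip (.seq (.pop r) P₀) (.seq (.pop r) P₁)) σ) ≤ size σ + g := by
  obtain ⟨T₀, h₀⟩ := h₀
  obtain ⟨T₁, h₁⟩ := h₁
  have hp := size_den_pop (O := O) hr h
  have hl := length_den_pop_self (O := O) σ r
  have hn := List.length_pos_iff.2 h
  have a₀ := (h₀ (den O (.pop r) σ)).1
  have a₁ := (h₁ (den O (.pop r) σ)).1
  have b₀ := n₀.length_den_le (O := O) (den O (.pop r) σ)
  have b₁ := n₁.length_den_le (O := O) (den O (.pop r) σ)
  rcases hc : σ r with _ | ⟨_ | _, l⟩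
  · exact absurd hc h
  · rw [den_branch_false hc, den, ← hc]; lia
  · rw [den_branch_true hc, den, ← hc]; lia

/-- Every branch pops stack `F` or stack `0`, so the sum of their lengths is a measure. -/
theorem readOnes_decreases {F g : ℕ} {P : Prog} (hF : F < 12) (hF0 : F ≠ 0)
    (hP : Tame O P (g + 1)) (n₀ : NoPush 0 P) (nF : NoPush F P) (σ : Store) (h : σ F ≠ []) :
    (den O (.branch 0 (.pop F) (.seq (.pop 0) (.pop F)) (.seq (.pop 0) P)) σ F).length +
      (den O (.branch 0 (.pop F) (.seq (.pop 0) (.pop F)) (.seq (.pop 0) P)) σ 0).length <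
      (σ F).length + (σ 0).length ∧
    size (den O (.branch 0 (.pop F) (.seq (.pop 0) (.pop F)) (.seq (.pop 0) P)) σ) ≤
      size σ + g := by
  obtain ⟨T, hP⟩ := hP
  have hn := List.length_pos_iff.2 h
  have a := (hP (den O (.pop 0) σ)).1
  have b₀ := n₀.length_den_le (O := O) (den O (.pop 0) σ)
  have bF := nF.length_den_le (O := O) (den O (.pop 0) σ)
  have l0 := length_den_pop_self (O := O) σ 0
  have lF := length_den_pop_self (O := O) σ F
  have l0' := length_den_pop_of_ne (O := O) σ hF0.symm
  have lF' := length_den_pop_of_ne (O := O) σ hF0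
  have hpF := size_den_pop (O := O) hF h
  rcases hc : σ 0 with _ | ⟨_ | _, l⟩
  · rw [den_branch_nil hc, ← hc]; lia
  · have hp := size_den_pop (O := O) (σ := σ) (r := 0) (by simp) (by simp [hc])
    have h' : den O (.pop 0) σ F ≠ [] := by rw [← List.length_pos_iff]; lia
    have := size_den_pop (O := O) hF h'
    have e0 := length_den_pop_of_ne (O := O) (den O (.pop 0) σ) hF0.symm
    have eF := length_den_pop_self (O := O) (den O (.pop 0) σ) F
    rw [den_branch_false hc, den, ← hc]; lia
  · have hp := size_den_pop (O := O) (σ := σ) (r := 0) (by simp) (by simp [hc])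
    have hn' : 0 < (σ 0).length := by simp [hc]
    rw [den_branch_true hc, den, ← hc]; lia

theorem tame_drain {r : ℕ} {P₀ P₁ : Prog} (hr : r < 12) (h₀ : Tame O P₀ 1)
    (h₁ : Tame O P₁ 1) (n₀ : NoPush r P₀) (n₁ : NoPush r P₁) : Tame O (drain r P₀ P₁) 0 :=
  tame_loop (fun σ => (σ r).length) (fun σ => length_le_size σ hr)
    (.branch tame_skip ((tame_pop hr).seq h₀) ((tame_pop hr).seq h₁))
    (drain_decreases hr h₀ h₁ n₀ n₁)

theorem polyTime_drain {r g₀ g₁ : ℕ} {P₀ P₁ : Prog} (hr : r < 12) (h₀ : Tame O P₀ g₀)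
    (h₁ : Tame O P₁ g₁) (n₀ : NoPush r P₀) (n₁ : NoPush r P₁) : PolyTime O (drain r P₀ P₁) :=
  polyTime_loop (fun σ => (σ r).length) (fun σ => length_le_size σ hr)
    (.branch tame_skip ((tame_pop hr).seq h₀) ((tame_pop hr).seq h₁))
    (drain_decreases (g := g₀ + g₁) hr (h₀.mono (by lia)) (h₁.mono (by lia)) n₀ n₁)

theorem tame_readOnes {F : ℕ} {P : Prog} (hF : F < 12) (hF0 : F ≠ 0) (hP : Tame O P 1)
    (n₀ : NoPush 0 P) (nF : NoPush F P) : Tame O (readOnes F P) 0 := by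
  have hdec := readOnes_decreases (g := 0) hF hF0 hP n₀ nF
  simp only [Nat.add_zero] at hdec
  exact tame_loop (fun σ => (σ F).length + (σ 0).length)
    (fun σ => length_add_length_le_size σ hF (by simp) hF0)
    (.branch (tame_pop hF) ((tame_pop (by simp)).seq (tame_pop hF)) ((tame_pop (by simp)).seq hP))
    hdec

theorem polyTime_readOnes {F g : ℕ} {P : Prog} (hF : F < 12) (hF0 : F ≠ 0) (hP : Tame O P g)
    (n₀ : NoPush 0 P) (nF : NoPush F P) : PolyTime O (readOnes F P) := by
  have hP' : Tame O P (g + 1) := hP.mono (Nat.le_succ g)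
  exact polyTime_loop (fun σ => (σ F).length + (σ 0).length)
    (fun σ => length_add_length_le_size σ hF (by simp) hF0)
    (.branch (tame_pop hF) ((tame_pop (by simp)).seq (tame_pop hF)) ((tame_pop (by simp)).seq hP))
    (readOnes_decreases hF hF0 hP' n₀ nF)

theorem tame_scan {F : ℕ} {P : Prog} (hF : F < 12) (hF0 : F ≠ 0) (hP : Tame O P 1)
    (n₀ : NoPush 0 P) (nF : NoPush F P) : Tame O (scan F P) 1 :=
  (tame_push hF true).seq (tame_readOnes hF hF0 hP n₀ nF)

theorem polyTime_scan {F g : ℕ} {P : Prog} (hF : F < 12) (hF0 : F ≠ 0) (hP : Tame O P g)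
    (n₀ : NoPush 0 P) (nF : NoPush F P) : PolyTime O (scan F P) :=
  (tame_push hF true).polyTime.seq (polyTime_readOnes hF hF0 hP n₀ nF)

theorem tame_move {r s : ℕ} (hr : r < 12) (hs : s < 12) : Tame O (move r s) 1 :=
  .branch tame_skip ((tame_pop hr).seq (tame_push hs _)) ((tame_pop hr).seq (tame_push hs _))

theorem tame_moveAll {r s : ℕ} (hr : r < 12) (hs : s < 12) (h : s ≠ r) :
    Tame O (moveAll r s) 0 := tame_drain hr (tame_push hs _) (tame_push hs _) h h

/-! ### Symbolic execution -/

/-- The store with the given stacks. -/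
def st (l : List (List Bool)) : Store := fun r => l.getD r []

theorem update_st {l : List (List Bool)} {r : ℕ} (hr : r < l.length) (v : List Bool) :
    Function.update (st l) r v = st (l.set r v) := by
  funext s
  by_cases h : s = r
  · subst h; simp [st, hr]
  · simp [st, Function.update_of_ne h, Ne.symm h]

theorem inputStore_eq_st (u v : List Bool) :
    inputStore u v = st [u, v, [], [], [], [], [], [], [], [], [], []] := by
  funext r
  rcases r with _ | _ | r
  · rfl
  · rfl
  · show [] = _
    simp only [st]
    repeat' (first | rfl | rcases r with _ | r)

theorem size_st (a0 a1 a2 a3 a4 a5 a6 a7 a8 a9 a10 a11 : List Bool) :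
    size (st [a0, a1, a2, a3, a4, a5, a6, a7, a8, a9, a10, a11]) =
      a0.length + a1.length + a2.length + a3.length + a4.length + a5.length + a6.length +
      a7.length + a8.length + a9.length + a10.length + a11.length := by
  simp [size, Finset.sum_range_succ, st]

theorem den_seq (P Q : Prog) (σ : Store) : den O (.seq P Q) σ = den O Q (den O P σ) := rfl

theorem den_skip (σ : Store) : den O .skip σ = σ := rfl

theorem den_push (l : List (List Bool)) (r : ℕ) (b : Bool) (hr : r < l.length) :
    den O (.push r b) (st l) = st (l.set r (b :: l.getD r [])) := update_st hr _

theorem den_pop (l : List (List Bool)) (r : ℕ) (hr : r < l.length) :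
    den O (.pop r) (st l) = st (l.set r (l.getD r []).tail) := update_st hr _

open Classical in
theorem den_query (l : List (List Bool)) (q a : ℕ) (ha : a < l.length) :
    den O (.query q a) (st l) = st (l.set a (decide (l.getD q [] ∈ O) :: l.getD a [])) :=
  update_st ha _

theorem den_branch (l : List (List Bool)) (r : ℕ) (E P₀ P₁ : Prog) :
    den O (.branch r E P₀ P₁) (st l) = match l.getD r [] with
      | [] => den O E (st l)
      | false :: _ => den O P₀ (st l)
      | true :: _ => den O P₁ (st l) := rfl

theorem den_drain_nil {l : List (List Bool)} {r : ℕ} {P₀ P₁ : Prog} (h : l.getD r [] = []) :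
    den O (drain r P₀ P₁) (st l) = st l := den_loop_nil h

theorem den_drain_cons {l : List (List Bool)} {r : ℕ} {P₀ P₁ : Prog} {b : Bool} {v : List Bool}
    (hr : r < l.length) (h : l.getD r [] = b :: v) :
    den O (drain r P₀ P₁) (st l) =
      den O (drain r P₀ P₁) (den O (bif b then P₁ else P₀) (st (l.set r v))) := by
  rw [drain, den_loop_cons (show st l r ≠ [] by simp only [st, h]; simp), den_branch, h]
  cases b <;> simp only [den_seq, den_pop _ _ hr, h, List.tail_cons, cond_true, cond_false]

theorem den_readOnes_nil {l : List (List Bool)} {F : ℕ} {P : Prog} (h : l.getD F [] = []) :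
    den O (readOnes F P) (st l) = st l := den_loop_nil h

theorem den_readOnes_false {l : List (List Bool)} {F : ℕ} {P : Prog} {v f : List Bool} {b : Bool}
    (h0 : l.getD 0 [] = false :: v) (hF : F < l.length) (hF0 : F ≠ 0)
    (h : l.getD F [] = b :: f) :
    den O (readOnes F P) (st l) = den O (readOnes F P) (st ((l.set 0 v).set F f)) := by
  rw [readOnes, den_loop_cons (show st l F ≠ [] by simp only [st, h]; simp), den_branch, h0]
  have h0' : 0 < l.length := by lia
  have hs : (l.set 0 v).getD F [] = b :: f := by
    rw [← h]; simp [List.getD_eq_getElem?_getD, Ne.symm hF0]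
  simp only [den_seq, den_pop _ _ h0', h0, List.tail_cons]
  rw [den_pop _ _ (by simpa using hF), hs, List.tail_cons]

theorem den_readOnes_true {l : List (List Bool)} {F : ℕ} {P : Prog} {v f : List Bool} {b : Bool}
    (h0 : l.getD 0 [] = true :: v) (h0' : 0 < l.length) (h : l.getD F [] = b :: f) :
    den O (readOnes F P) (st l) = den O (readOnes F P) (den O P (st (l.set 0 v))) := by
  rw [readOnes, den_loop_cons (show st l F ≠ [] by simp only [st, h]; simp), den_branch, h0]
  simp only [den_seq, den_pop _ _ h0', h0, List.tail_cons]

theorem den_move (l : List (List Bool)) (r s : ℕ) (hr : r < l.length) (hs : s < l.length) :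
    den O (move r s) (st l) = match l.getD r [] with
      | [] => st l
      | b :: v => st ((l.set r v).set s (b :: (l.set r v).getD s [])) := by
  rw [move, den_branch]
  rcases h : l.getD r [] with _ | ⟨_ | _, v⟩
  · rfl
  · simp only [den_seq, den_pop _ _ hr, h, List.tail_cons]
    exact den_push _ _ _ (by simpa using hs)
  · simp only [den_seq, den_pop _ _ hr, h, List.tail_cons]
    exact den_push _ _ _ (by simpa using hs)

theorem den_moveAll (l : List (List Bool)) (r s : ℕ) (hr : r < l.length) (hs : s < l.length)
    (hrs : r ≠ s) :
    den O (moveAll r s) (st l) =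
      st ((l.set r []).set s ((l.getD r []).reverse ++ l.getD s [])) := by
  generalize hv : l.getD r [] = v
  induction v generalizing l with
  | nil =>
    rw [moveAll, den_drain_nil hv]
    congr 1
    apply List.ext_getElem? fun i => ?_
    rw [List.getElem?_set, List.getElem?_set]
    simp only [List.getD_eq_getElem?_getD] at hv ⊢
    split_ifs <;> simp_all
  | cons b v ih =>
    rw [moveAll, den_drain_cons hr hv, ← moveAll]
    have hc : den O (bif b then .push s true else .push s false) (st (l.set r v)) =
        st ((l.set r v).set s (b :: l.getD s [])) := by
      have : (l.set r v).getD s [] = l.getD s [] := by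
        simp [List.getD_eq_getElem?_getD, hrs]
      cases b <;> simp only [cond_true, cond_false] <;>
        rw [den_push _ _ _ (by simpa using hs), this]
    rw [hc, ih _ (by simpa using hr) (by simpa using hs)
      (by rw [List.getD_eq_getElem?_getD, List.getElem?_set_ne hrs.symm]; simp [hr])]
    congr 1
    apply List.ext_getElem? fun i => ?_
    simp only [List.getD_eq_getElem?_getD, List.getElem?_set, List.length_set]
    split_ifs <;> simp_all

/-! ### The verifier -/

/-- Move the negation of the top bit of stack `r` to stack `s`. -/
def moveNot (r s : ℕ) : Prog :=
  .branch r .skip (.seq (.pop r) (.push s true)) (.seq (.pop r) (.push s false))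

/-- Read one coordinate `u x` from stack `0` and push its value in the assignment on stack `3`: it
is `x` or its negation if there is a bit `1` or `0` on stack `9`, and otherwise it is `x` if `u` is
set and the next bit of stack `1` if not. -/
def readInput : Prog :=
  .branch 9
    (.branch 0 .skip
      (.seq (.pop 0) (.seq (.pop 0) (.branch 1 (.push 3 false) (move 1 3) (move 1 3))))
      (.seq (.pop 0) (.seq (.pop 1) (move 0 3))))
    (.seq (.pop 9) (.seq (.pop 0) (.seq (.pop 1) (moveNot 0 3))))
    (.seq (.pop 9) (.seq (.pop 0) (.seq (.pop 1) (move 0 3))))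

/-- Read a wire number from stack `0` and push the value of this wire on stack `6`; stack `5` holds
the values of the wires. -/
def lookup : Prog :=
  .seq (scan 11 (move 5 7)) (.seq
    (.branch 5 (.push 6 false) (.push 6 false) (.push 6 true)) (moveAll 7 5))

/-- Read a gate from stack `0` and append its value to stack `5`. -/
def evalGate : Prog :=
  .seq (.branch 0 .skip
    (.seq (.pop 0) (.branch 0 .skip (.seq (.pop 0) (move 0 6))
      (.seq (.pop 0) (.seq lookup (moveNot 6 6)))))
    (.seq (.pop 0) (.branch 0 .skip
      (.seq (.pop 0) (.seq lookup (.seq lookup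
        (.branch 6 .skip (.seq (.pop 6) (.seq (.pop 6) (.push 6 false))) (.pop 6)))))
      (.seq (.pop 0) (.seq lookup (.seq lookup
        (.branch 6 .skip (.pop 6) (.seq (.pop 6) (.seq (.pop 6) (.push 6 true))))))))))
  (.seq (moveAll 5 7) (.seq (move 6 7) (moveAll 7 5)))

/-- Evaluate an encoded circuit on the partial assignment that precedes it, completed by the witness,
and compare the value with the target bit. -/
def verifier : Prog :=
  .seq (scan 10 (move 0 9)) (.seq (scan 10 readInput) (.seq (moveAll 3 5) (.seq (move 0 4)
  (.seq (scan 10 .skip) (.seq (scan 10 evalGate) (.seq lookup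
  (.seq (.branch 4 .skip (moveNot 6 6) .skip) (.seq (drain 0 .skip .skip) (move 6 0)))))))))

/-! ### Running time of the verifier. -/

theorem tame_moveNot {r s : ℕ} (hr : r < 12) (hs : s < 12) : Tame O (moveNot r s) 1 :=
  .branch tame_skip ((tame_pop hr).seq (tame_push hs _)) ((tame_pop hr).seq (tame_push hs _))

theorem tame_readInput : Tame O readInput 1 := by
  have p : ∀ {r : ℕ}, r < 12 → Tame O (.pop r) 0 := tame_pop
  exact .branch
    (.branch tame_skip
      ((p (by simp)).seq ((p (by simp)).seq (.branch (tame_push (by simp) _)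
        (tame_move (by simp) (by simp)) (tame_move (by simp) (by simp)))))
      ((p (by simp)).seq ((p (by simp)).seq (tame_move (by simp) (by simp)))))
    ((p (by simp)).seq ((p (by simp)).seq ((p (by simp)).seq (tame_moveNot (by simp) (by simp)))))
    ((p (by simp)).seq ((p (by simp)).seq ((p (by simp)).seq (tame_move (by simp) (by simp)))))

theorem exists_tame_lookup : ∃ g, Tame O lookup g :=
  ⟨_, (tame_scan (by simp) (by simp) (tame_move (by simp) (by simp)) (by simp [NoPush, move])
      (by simp [NoPush, move])).seq
    (.seq (.branch (tame_push (by simp) _) (tame_push (by simp) _) (tame_push (by simp) _))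
      (tame_moveAll (by simp) (by simp) (by simp)))⟩

/-- A gate is evaluated inside the scan over all gates, so an additive bound is required although
`lookup` contains loops. The inner scan uses flag stack 11 because the outer one must not see pushes
on its own flag stack 10. -/
theorem exists_tame_evalGate : ∃ g, Tame O evalGate g := by
  obtain ⟨g, hl⟩ := exists_tame_lookup (O := O)
  have p : ∀ {r : ℕ}, r < 12 → Tame O (.pop r) 0 := tame_pop
  exact ⟨_, .seq (.branch tame_skip
    ((p (by simp)).seq (.branch tame_skip ((p (by simp)).seq (tame_move (by simp) (by simp)))
      ((p (by simp)).seq (hl.seq (tame_moveNot (by simp) (by simp))))))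
    ((p (by simp)).seq (.branch tame_skip
      ((p (by simp)).seq (hl.seq (hl.seq (.branch tame_skip
        ((p (by simp)).seq ((p (by simp)).seq (tame_push (by simp) _))) (p (by simp))))))
      ((p (by simp)).seq (hl.seq (hl.seq (.branch tame_skip (p (by simp))
        ((p (by simp)).seq ((p (by simp)).seq (tame_push (by simp) _))))))))))
    ((tame_moveAll (by simp) (by simp) (by simp)).seq
      ((tame_move (by simp) (by simp)).seq (tame_moveAll (by simp) (by simp) (by simp))))⟩

theorem polyTime_verifier : PolyTime O verifier := by
  obtain ⟨g, hl⟩ := exists_tame_lookup (O := O)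
  obtain ⟨g', hg⟩ := exists_tame_evalGate (O := O)
  exact .seq (tame_scan (by simp) (by simp) (tame_move (by simp) (by simp))
      (by simp [NoPush, move]) (by simp [NoPush, move])).polyTime
    (.seq (tame_scan (by simp) (by simp) tame_readInput (by simp [NoPush, move, moveNot, readInput])
      (by simp [NoPush, move, moveNot, readInput])).polyTime
    (.seq (tame_moveAll (by simp) (by simp) (by simp)).polyTime
    (.seq (tame_move (by simp) (by simp)).polyTime
    (.seq (polyTime_scan (by simp) (by simp) tame_skip trivial trivial)
    (.seq (polyTime_scan (by simp) (by simp) hg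
      (by simp [NoPush, move, moveNot, evalGate, lookup, moveAll, drain, scan, readOnes])
      (by simp [NoPush, move, moveNot, evalGate, lookup, moveAll, drain, scan, readOnes]))
    (.seq hl.polyTime
    (.seq (Tame.branch tame_skip (tame_moveNot (by simp) (by simp)) tame_skip).polyTime
    (.seq (polyTime_drain (by simp) tame_skip tame_skip trivial trivial)
      (tame_move (by simp) (by simp)).polyTime))))))))

theorem isDeterministic_verifier : verifier.IsDeterministic := by
  simp [verifier, Prog.IsDeterministic, move, moveNot, evalGate, lookup, moveAll, drain, scan,
    readOnes, readInput]

/-- The values of the wires that a partial assignment and a witness give to the inputs. -/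
def assignment : List (Bool × Bool) → List Bool → List Bool → List Bool
  | [], _, _ => []
  | (u, x) :: cs, a, w =>
    (match a with
      | [] => if u then x else w.headD false
      | v :: _ => if v then x else !x) :: assignment cs a.tail w.tail

/-- Each entry is announced by a `1`, so that a following `0` ends the list for `scan`. -/
def encodePrefix (l : List Bool) : List Bool := l.flatMap fun v => [true, v]

def encodeInputs (cs : List (Bool × Bool)) : List Bool := cs.flatMap fun c => [true, c.1, c.2]

/-- The query whether some completion of a partial assignment gives the encoded circuit the value
`b`. -/
def queryString (a : List Bool) (cs : List (Bool × Bool)) (b : Bool) (C : List Bool) : List Bool :=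
  encodePrefix a.reverse ++ false :: (encodeInputs cs ++ false :: b :: C)

/-- Moving bits to another stack reverses them. As `queryString` stores the prefix reversed, it
arrives on stack 9 in order. -/
theorem den_readOnes_prefix (l rest s1 s2 s3 s4 s5 s6 s7 s8 s9 s11 : List Bool) :
    den O (readOnes 10 (move 0 9))
      (st [encodePrefix l ++ false :: rest, s1, s2, s3, s4, s5, s6, s7, s8, s9, [true], s11]) =
      st [rest, s1, s2, s3, s4, s5, s6, s7, s8, l.reverse ++ s9, [], s11] := by
  induction l generalizing s9 with
  | nil =>
    rw [den_readOnes_false (v := rest) (f := []) (b := true) (by simp [encodePrefix])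
      (by simp) (by simp) (by simp), den_readOnes_nil (by simp)]
    simp
  | cons v l ih =>
    rw [den_readOnes_true (v := v :: (encodePrefix l ++ false :: rest)) (b := true)
      (f := []) (by simp [encodePrefix]) (by simp) (by simp)]
    simp [den_move, ih]

theorem den_scan_prefix (l rest s1 s2 s3 s4 s5 s6 s7 s8 s9 s11 : List Bool) :
    den O (scan 10 (move 0 9))
      (st [encodePrefix l ++ false :: rest, s1, s2, s3, s4, s5, s6, s7, s8, s9, [], s11]) =
      st [rest, s1, s2, s3, s4, s5, s6, s7, s8, l.reverse ++ s9, [], s11] := by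
  rw [scan, den_seq, den_push _ _ _ (by simp)]
  exact den_readOnes_prefix ..

/-- The leftovers `a'` and `w'` of the prefix and the witness play no further role. The values are
reversed here and put in order by the `moveAll` that follows in `verifier`. -/
theorem den_scan_inputs (cs : List (Bool × Bool)) (a w rest s2 s3 s4 s5 s6 s7 s8 s11 : List Bool) :
    ∃ a' w', den O (scan 10 readInput)
      (st [encodeInputs cs ++ false :: rest, w, s2, s3, s4, s5, s6, s7, s8, a, [], s11]) =
      st [rest, w', s2, (assignment cs a w).reverse ++ s3, s4, s5, s6, s7, s8, a', [], s11] := by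
  rw [scan, den_seq, den_push _ _ _ (by simp)]
  simp only [List.set, List.getD_cons_succ]
  change ∃ a' w', den O _ (st [_, _, _, _, _, _, _, _, _, _, [true], _]) = _
  induction cs generalizing a w s3 with
  | nil =>
    refine ⟨a, w, ?_⟩
    rw [den_readOnes_false (v := rest) (f := []) (b := true) (by simp [encodeInputs])
      (by simp) (by simp) (by simp), den_readOnes_nil (by simp)]
    simp [assignment]
  | cons c cs ih =>
    obtain ⟨u, x⟩ := c
    obtain ⟨a', w', h⟩ := ih a.tail w.tail ((assignment ((u, x) :: cs) a w).headD false :: s3)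
    refine ⟨a', w', ?_⟩
    rw [den_readOnes_true (v := u :: x :: (encodeInputs cs ++ false :: rest)) (b := true)
      (f := []) (by simp [encodeInputs]) (by simp) (by simp)]
    rcases a with _ | ⟨_ | _, a⟩ <;> rcases w with _ | ⟨_ | _, w⟩ <;> cases u <;> cases x <;>
      simpa [readInput, move, moveNot, den_seq, den_branch, den_pop, den_push, den_skip,
        assignment] using h

theorem den_moveNot (l : List (List Bool)) (r s : ℕ) (hr : r < l.length) (hs : s < l.length) :
    den O (moveNot r s) (st l) = match l.getD r [] with
      | [] => st l
      | b :: v => st ((l.set r v).set s ((!b) :: (l.set r v).getD s [])) := by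
  rw [moveNot, den_branch]
  rcases h : l.getD r [] with _ | ⟨_ | _, v⟩
  · rfl
  · simp only [den_seq, den_pop _ _ hr, h, List.tail_cons]
    exact den_push _ _ _ (by simpa using hs)
  · simp only [den_seq, den_pop _ _ hr, h, List.tail_cons]
    exact den_push _ _ _ (by simpa using hs)

theorem den_readOnes_skip (k : ℕ) (rest s1 s2 s3 s4 s5 s6 s7 s8 s9 s11 : List Bool) :
    den O (readOnes 10 .skip)
      (st [encodeNat k ++ rest, s1, s2, s3, s4, s5, s6, s7, s8, s9, [true], s11]) =
      st [rest, s1, s2, s3, s4, s5, s6, s7, s8, s9, [], s11] := by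
  induction k with
  | zero =>
    rw [den_readOnes_false (v := rest) (f := []) (b := true) (by simp [encodeNat]) (by simp)
      (by simp) (by simp), den_readOnes_nil (by simp)]
    simp
  | succ k ih =>
    rw [den_readOnes_true (v := encodeNat k ++ rest) (b := true) (f := [])
      (by simp [encodeNat, List.replicate_succ]) (by simp) (by simp)]
    simpa [den_skip] using ih

theorem den_readOnes_move_5_7 (k : ℕ)
    (rest s1 s2 s3 s4 s5 s6 s7 s8 s9 s10 : List Bool) :
    den O (readOnes 11 (move 5 7))
      (st [encodeNat k ++ rest, s1, s2, s3, s4, s5, s6, s7, s8, s9, s10, [true]]) =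
      st [rest, s1, s2, s3, s4, s5.drop k, s6, (s5.take k).reverse ++ s7, s8, s9, s10, []] := by
  induction k generalizing s5 s7 with
  | zero =>
    rw [den_readOnes_false (v := rest) (f := []) (b := true) (by simp [encodeNat]) (by simp)
      (by simp) (by simp), den_readOnes_nil (by simp)]
    simp
  | succ k ih =>
    rw [den_readOnes_true (v := encodeNat k ++ rest) (b := true) (f := [])
      (by simp [encodeNat, List.replicate_succ]) (by simp) (by simp)]
    rcases s5 with _ | ⟨b, s5⟩
    · simpa [den_move] using ih [] s7
    · simp [den_move, ih]

/-- The first `k` wires are set aside on stack 7, the next one is copied, and the wires are put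
back. An exhausted stack yields `false`, the default used by `Gate.eval`. -/
theorem den_lookup (k : ℕ) (rest s1 s2 s3 s4 s5 s6 s8 s9 s10 : List Bool) :
    den O lookup (st [encodeNat k ++ rest, s1, s2, s3, s4, s5, s6, [], s8, s9, s10, []]) =
      st [rest, s1, s2, s3, s4, s5, s5.getD k false :: s6, [], s8, s9, s10, []] := by
  have h : s5.getD k false = (s5.drop k).headD false := by
    simp [List.getD_eq_getElem?_getD, List.head?_drop, List.headD_eq_head?_getD]
  have h' := List.take_append_drop k s5
  rw [lookup, den_seq, den_seq, scan, den_seq, den_push _ _ _ (by simp), h]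
  simp only [List.set, List.getD_cons_succ, List.getD_cons_zero, den_readOnes_move_5_7]
  rw [den_branch]
  rcases hd : s5.drop k with _ | ⟨_ | _, v⟩ <;> rw [hd] at h' <;>
    simp [den_push, den_moveAll, h']

/-- New wires belong at the end of the list, that is, at the bottom of stack 5; hence the detour
through stack 7. -/
theorem den_evalGate (g : Gate) (rest s1 s2 s3 s4 s5 s8 s9 s10 : List Bool) :
    den O evalGate (st [g.encode ++ rest, s1, s2, s3, s4, s5, [], [], s8, s9, s10, []]) =
      st [rest, s1, s2, s3, s4, s5 ++ [g.eval s5], [], [], s8, s9, s10, []] := by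
  rcases g with b | i | ⟨i, j⟩ | ⟨i, j⟩
  · simp [evalGate, den_seq, den_branch, den_pop, den_move, den_moveAll, Gate.encode, Gate.eval]
  · simp [evalGate, den_seq, den_branch, den_pop, den_move, den_moveNot, den_moveAll, Gate.encode,
      Gate.eval, den_lookup]
  · cases h : s5.getD i false <;> cases h' : s5.getD j false <;>
      simp only [List.getD_eq_getElem?_getD] at h h' <;>
      simp [evalGate, den_seq, den_branch, den_pop, den_push, den_move, den_moveAll, Gate.encode,
        Gate.eval, den_lookup, h, h']
  · cases h : s5.getD i false <;> cases h' : s5.getD j false <;>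
      simp only [List.getD_eq_getElem?_getD] at h h' <;>
      simp [evalGate, den_seq, den_branch, den_pop, den_push, den_move, den_moveAll, Gate.encode,
        Gate.eval, den_lookup, h, h']

theorem den_readOnes_evalGate (gs : List Gate) (rest s1 s2 s3 s4 s5 s8 s9 : List Bool) :
    den O (readOnes 10 evalGate)
      (st [gs.flatMap (fun g => true :: g.encode) ++ false :: rest,
        s1, s2, s3, s4, s5, [], [], s8, s9, [true], []]) =
      st [rest, s1, s2, s3, s4, gs.foldl (fun wires g => wires ++ [g.eval wires]) s5,
        [], [], s8, s9, [], []] := by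
  induction gs generalizing s5 with
  | nil =>
    rw [den_readOnes_false (v := rest) (f := []) (b := true) (by simp) (by simp) (by simp)
      (by simp), den_readOnes_nil (by simp)]
    simp
  | cons g gs ih =>
    rw [den_readOnes_true
      (v := g.encode ++ (gs.flatMap (fun g => true :: g.encode) ++ false :: rest))
      (b := true) (f := []) (by simp) (by simp) (by simp), List.set_cons_zero, den_evalGate, ih,
      List.foldl_cons]

theorem den_drain_skip (s0 s1 s2 s3 s4 s5 s6 s7 s8 s9 s10 s11 : List Bool) :
    den O (drain 0 .skip .skip) (st [s0, s1, s2, s3, s4, s5, s6, s7, s8, s9, s10, s11]) =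
      st [[], s1, s2, s3, s4, s5, s6, s7, s8, s9, s10, s11] := by
  induction s0 with
  | nil => exact den_drain_nil rfl
  | cons b l ih =>
    rw [den_drain_cons (b := b) (v := l) (by simp) (by simp), Bool.cond_self, den_skip,
      List.set_cons_zero, ih]

/-- The value of the output wire, given the values of the input wires. -/
def evalWires {n : ℕ} (C : Circuit n) (l : List Bool) : Bool :=
  (C.gates.foldl (fun wires g => wires ++ [g.eval wires]) l).getD C.out false

theorem den_verifier {n : ℕ} (C : Circuit n) (a : List Bool) (cs : List (Bool × Bool)) (b : Bool)
    (w : List Bool) :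
    den O verifier (inputStore (queryString a cs b C.encode) w) 0 =
      [evalWires C (assignment cs a w) == b] := by
  rw [inputStore_eq_st, verifier, den_seq, queryString, den_scan_prefix, den_seq]
  obtain ⟨a', w', h⟩ := den_scan_inputs (O := O) cs (a.reverse.reverse ++ []) w
    (b :: C.encode) [] [] [] [] [] [] [] []
  rw [h]
  have e : C.encode = encodeNat n ++ (C.gates.flatMap (fun g => true :: g.encode) ++
      false :: (encodeNat C.out ++ [])) := by simp [Circuit.encode]
  simp only [den_seq, scan]
  rw [den_moveAll _ _ _ (by simp) (by simp) (by simp)]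
  simp only [List.set, List.getD_cons_succ, List.getD_cons_zero, List.append_nil,
    List.reverse_reverse]
  rw [den_move _ _ _ (by simp) (by simp)]
  simp only [List.set, List.getD_cons_succ, List.getD_cons_zero]
  rw [den_push _ _ _ (by simp), e]
  simp only [List.set, List.getD_cons_succ, List.getD_cons_zero]
  rw [den_readOnes_skip, den_push _ _ _ (by simp)]
  simp only [List.set, List.getD_cons_succ, List.getD_cons_zero]
  rw [den_readOnes_evalGate, den_lookup, ← evalWires]
  -- The final branch negates the value when the target is `0`, which amounts to comparing it with
  -- `b`.
  cases b <;> cases evalWires C (assignment cs a w) <;>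
    simp [den_branch, den_moveNot, den_skip, den_drain_skip, den_move, st]

/-! ### The oracle -/

/-- Strings that the verifier accepts with some witness that is not longer than the string. -/
def oracle : Language Bool :=
  {x | ∃ w : List Bool, w.length ≤ x.length ∧ den 0 verifier (inputStore x w) 0 = [true]}

theorem size_inputStore (u v : List Bool) : size (inputStore u v) = u.length + v.length := by
  simp [inputStore_eq_st, size_st]

/-- The time bound of the verifier holds from every store, so malformed strings need no separate
check. -/
theorem inNP_oracle : InNP oracle := by
  obtain ⟨T, G, h⟩ := polyTime_verifier (O := 0)
  have hrun : ∀ x w coins : List Bool, coins.length = T.eval (x.length + w.length) →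
      run 0 verifier (inputStore x w) coins = ⟨[], den 0 verifier (inputStore x w)⟩ := by
    intro x w coins hc
    obtain ⟨-, t, ht, he⟩ := h (inputStore x w)
    exact he.run_eq (by rwa [hc, ← size_inputStore])
  refine ⟨verifier, T, .X, isDeterministic_verifier, fun x w coins hc => ?_, fun x => ?_⟩
  · rw [hrun x w coins hc]
  · simp only [hrun x _ _ List.length_replicate, Polynomial.eval_X]
    rfl

theorem queryString_mem_oracle {n : ℕ} (C : Circuit n) (a : List Bool) (cs : List (Bool × Bool))
    (b : Bool) : queryString a cs b C.encode ∈ oracle ↔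
      ∃ w : List Bool, w.length ≤ (queryString a cs b C.encode).length ∧
        evalWires C (assignment cs a w) = b := by
  change (∃ w : List Bool, _ ∧ _) ↔ _
  simp [den_verifier]

theorem getElem?_assignment (cs : List (Bool × Bool)) (a w : List Bool) (i : ℕ) :
    (assignment cs a w)[i]? = cs[i]?.map fun c => match a[i]? with
      | none => if c.1 then c.2 else w.getD i false
      | some v => if v then c.2 else !c.2 := by
  induction cs generalizing a w i with
  | nil => simp [assignment]
  | cons c cs ih =>
    obtain ⟨u, x⟩ := c
    rcases i with _ | i
    · rcases a with _ | ⟨v, a⟩ <;> rcases w with _ | ⟨v', w⟩ <;> simp [assignment]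
    · rcases a with _ | ⟨v, a⟩ <;> rcases w with _ | ⟨v', w⟩ <;> simp [assignment, ih]

/-! ### The algorithm -/

def prepareBit (v : Bool) : Prog :=
  .seq (.push 2 v) (.seq (.push 3 false) (.seq (.push 4 true) (.push 6 true)))

/-- Move the input point from stack `1` to stack `2`, and initialize the set on stack `3` and the
counters on stacks `4` and `6`. -/
def prepare : Prog := drain 1 (prepareBit false) (prepareBit true)

def buildBit (v : Bool) : Prog := .seq (.push 0 v) (.seq (move 3 0) (.push 0 true))

/-- Add the coordinates on stacks `2` and `3` and the target bit `b` to the circuit on stack `0`. -/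
def build (b : Bool) : Prog :=
  .seq (.push 0 b) (.seq (.push 0 false)
    (.seq (drain 2 (buildBit false) (buildBit true)) (.push 0 false)))

/-- Extend the prefix of the partial assignment by a `1` if the oracle admits this, and by a `0` if
not. -/
def extendPrefix : Prog :=
  .seq (.push 8 true) (.seq (.push 0 true) (.seq (.push 0 true) (.seq (.query 0 7)
    (.branch 7 .skip
      (.seq (.pop 7) (.seq (.pop 0) (.seq (.pop 0) (.seq (.push 0 false) (.push 0 true)))))
      (.pop 7)))))

/-- Fix all coordinates; the counter on stack `6` is kept. -/
def extendAll : Prog := .seq (drain 6 extendPrefix extendPrefix) (moveAll 8 6)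

/-- Move a coordinate from stack `0` to the stacks `2` and `3`, where it is added to the set if there
is a `0` on stack `9`. -/
def readBack : Prog :=
  .seq
    (.branch 9 (move 0 3) (.seq (.pop 9) (.seq (.pop 0) (.push 3 true)))
      (.seq (.pop 9) (move 0 3)))
    (move 0 2)

/-- If there is an assignment with value `b` that agrees with the input on the current set, find one
and add the coordinates where it differs from the input. -/
def round (b : Bool) : Prog :=
  .seq (build b) (.seq (.query 0 7) (.seq (.branch 7 .skip (.pop 7) (.seq (.pop 7) extendAll))
  (.seq (scan 10 (move 0 9)) (.seq (scan 10 readBack) (.pop 0)))))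

def rounds : Prog := .loop 4 (.seq (.pop 4) (.seq (round true) (round false)))

/-- The algorithm: output the set that is reached after `n` rounds for each of the two targets. -/
def certify : Prog := .seq prepare (.seq rounds (.seq (drain 0 .skip .skip) (moveAll 3 0)))

/-! ### Running time of the subroutines of the algorithm. -/

theorem polyTime_prepare : PolyTime O prepare :=
  polyTime_drain (by simp)
    ((tame_push (by simp) _).seq ((tame_push (by simp) _).seq ((tame_push (by simp) _).seq
      (tame_push (by simp) _))))
    ((tame_push (by simp) _).seq ((tame_push (by simp) _).seq ((tame_push (by simp) _).seq
      (tame_push (by simp) _)))) (by simp [prepareBit, NoPush]) (by simp [prepareBit, NoPush])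

theorem tame_buildBit (v : Bool) : Tame O (buildBit v) 3 :=
  (tame_push (by simp) _).seq ((tame_move (by simp) (by simp)).seq (tame_push (by simp) _))

theorem polyTime_build (b : Bool) : PolyTime O (build b) :=
  (tame_push (by simp) _).polyTime.seq ((tame_push (by simp) _).polyTime.seq
    ((polyTime_drain (by simp) (tame_buildBit _) (tame_buildBit _)
      (by simp [buildBit, NoPush, move]) (by simp [buildBit, NoPush, move])).seq
      (tame_push (by simp) _).polyTime))

theorem exists_tame_extendPrefix : ∃ g, Tame O extendPrefix g :=
  ⟨_, (tame_push (by simp) _).seq ((tame_push (by simp) _).seq ((tame_push (by simp) _).seq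
    ((tame_query 0 (by simp)).seq (.branch tame_skip ((tame_pop (by simp)).seq
      ((tame_pop (by simp)).seq ((tame_pop (by simp)).seq ((tame_push (by simp) _).seq
        (tame_push (by simp) _))))) (tame_pop (by simp))))))⟩

theorem polyTime_extendAll : PolyTime O extendAll := by
  obtain ⟨g, hg⟩ := exists_tame_extendPrefix (O := O)
  exact (polyTime_drain (by simp) hg hg (by simp [extendPrefix, NoPush])
    (by simp [extendPrefix, NoPush])).seq (tame_moveAll (by simp) (by simp) (by simp)).polyTime

theorem tame_readBack : Tame O readBack 2 :=
  (Tame.branch (tame_move (by simp) (by simp))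
    ((tame_pop (by simp)).seq ((tame_pop (by simp)).seq (tame_push (by simp) _)))
    ((tame_pop (by simp)).seq (tame_move (by simp) (by simp)))).seq
      (tame_move (by simp) (by simp))

theorem polyTime_round (b : Bool) : PolyTime O (round b) :=
  (polyTime_build b).seq ((tame_query 0 (by simp)).polyTime.seq
    ((PolyTime.branch tame_skip.polyTime (tame_pop (by simp)).polyTime
      ((tame_pop (by simp)).polyTime.seq polyTime_extendAll)).seq
    ((tame_scan (by simp) (by simp) (tame_move (by simp) (by simp))
      (by simp [NoPush, move]) (by simp [NoPush, move])).polyTime.seq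
    ((polyTime_scan (by simp) (by simp) tame_readBack
      (by simp [NoPush, move, readBack]) (by simp [NoPush, move, readBack])).seq
      (tame_pop (by simp)).polyTime))))

/-- The stacks between two rounds. -/
def roundStore (C : List Bool) (cs : List (Bool × Bool)) (k m : ℕ) : Store :=
  st [C, [], (cs.map Prod.snd).reverse, (cs.map Prod.fst).reverse, List.replicate k true, [],
    List.replicate m true, [], [], [], [], []]

open Classical in
/-- The bits found by asking `q` about one bit after the other. -/
noncomputable def greedy (q : List Bool → Prop) : ℕ → List Bool
  | 0 => []
  | t + 1 => greedy q t ++ [decide (q (greedy q t ++ [true]))]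

open Classical in
/-- `greedy`, or no bits at all if `q` fails from the beginning. -/
noncomputable def greedyOrNil (q : List Bool → Prop) (n : ℕ) : List Bool :=
  if q [] then greedy q n else []

theorem length_greedy (q : List Bool → Prop) (t : ℕ) : (greedy q t).length = t := by
  induction t with
  | zero => rfl
  | succ t ih => simp [greedy, ih]

theorem length_greedyOrNil_le (q : List Bool → Prop) (t : ℕ) : (greedyOrNil q t).length ≤ t := by
  rw [greedyOrNil]
  split_ifs
  · exact (length_greedy q t).le
  · simp

/-- Add the positions of the bits `0` to the set. -/
def updateInputs : List (Bool × Bool) → List Bool → List (Bool × Bool)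
  | [], _ => []
  | (u, x) :: cs, a => (u || !(a.headD true), x) :: updateInputs cs a.tail

/-! ### Symbolic execution of one round. -/

theorem den_prepare (C l s2 s3 s4 s6 : List Bool) :
    den O prepare (st [C, l, s2, s3, s4, [], s6, [], [], [], [], []]) =
      st [C, [], l.reverse ++ s2, List.replicate l.length false ++ s3,
        List.replicate l.length true ++ s4, [], List.replicate l.length true ++ s6,
        [], [], [], [], []] := by
  induction l generalizing s2 s3 s4 s6 with
  | nil => exact den_drain_nil rfl
  | cons v l ih =>
    rw [prepare, den_drain_cons (b := v) (v := l) (by simp) (by simp), ← prepare]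
    cases v <;> simp [prepareBit, den_seq, den_push, ih, List.replicate_succ']

/-- Between rounds, stacks 2 and 3 hold the coordinates with the last one on top, so pushing them in
turn produces the encoding in the right order. -/
theorem den_build_drain (q : List Bool) (rs : List (Bool × Bool))
    (s1 s4 s5 s6 s7 s8 s9 s10 s11 : List Bool) :
    den O (drain 2 (buildBit false) (buildBit true))
      (st [q, s1, rs.map Prod.snd, rs.map Prod.fst, s4, s5, s6, s7, s8, s9, s10, s11]) =
      st [encodeInputs rs.reverse ++ q, s1, [], [], s4, s5, s6, s7, s8, s9, s10, s11] := by
  induction rs generalizing q with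
  | nil => exact den_drain_nil rfl
  | cons c rs ih =>
    obtain ⟨u, x⟩ := c
    rw [den_drain_cons (b := x) (v := rs.map Prod.snd) (by simp) (by simp)]
    have hb : den O (bif x then buildBit true else buildBit false) (st [q, s1, rs.map Prod.snd,
        u :: rs.map Prod.fst, s4, s5, s6, s7, s8, s9, s10, s11]) = st [true :: u :: x :: q, s1,
        rs.map Prod.snd, rs.map Prod.fst, s4, s5, s6, s7, s8, s9, s10, s11] := by
      cases x <;> simp [buildBit, den_seq, den_push, den_move]
    simp only [List.set, List.map_cons]
    rw [hb, ih]
    simp [encodeInputs]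

theorem den_build (b : Bool) (C : List Bool) (cs : List (Bool × Bool)) (k m : ℕ) :
    den O (build b) (roundStore C cs k m) =
      st [queryString [] cs b C, [], [], [], List.replicate k true, [],
        List.replicate m true, [], [], [], [], []] := by
  have := den_build_drain (O := O) (false :: b :: C) cs.reverse [] (List.replicate k true) []
    (List.replicate m true) [] [] [] [] []
  rw [List.map_reverse, List.map_reverse, List.reverse_reverse] at this
  simp [build, roundStore, den_seq, den_push, this, queryString, encodePrefix]

/-- The purpose of storing the prefix reversed: the next query arises from the current one by two
pushes. -/
theorem queryString_append (a C : List Bool) (cs : List (Bool × Bool)) (b v : Bool) :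
    queryString (a ++ [v]) cs b C = true :: v :: queryString a cs b C := by
  simp [queryString, encodePrefix]

theorem den_extendPrefix (a C : List Bool) (cs : List (Bool × Bool)) (b : Bool)
    (s1 s2 s3 s4 s5 s6 s8 s9 s10 s11 : List Bool) :
    den O extendPrefix (st [queryString a cs b C, s1, s2, s3, s4, s5, s6, [], s8, s9, s10, s11]) =
      st [queryString (a ++ [@decide (queryString (a ++ [true]) cs b C ∈ O)
          (Classical.propDecidable _)]) cs b C,
        s1, s2, s3, s4, s5, s6, [], true :: s8, s9, s10, s11] := by
  by_cases h : queryString (a ++ [true]) cs b C ∈ O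
  · simp only [h, decide_true]
    rw [queryString_append] at h
    simp [extendPrefix, den_seq, den_push, den_query, h, den_branch, den_pop, queryString_append]
  · simp only [h, decide_false]
    rw [queryString_append] at h
    simp [extendPrefix, den_seq, den_push, den_query, h, den_branch, den_pop, queryString_append]

theorem den_extendAll_drain (C : List Bool) (cs : List (Bool × Bool)) (b : Bool) (t k : ℕ)
    (s1 s2 s3 s4 s5 s8 s9 s10 s11 : List Bool) :
    den O (drain 6 extendPrefix extendPrefix)
      (st [queryString (greedy (fun a => queryString a cs b C ∈ O) t) cs b C,
        s1, s2, s3, s4, s5, List.replicate k true, [], s8, s9, s10, s11]) =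
      st [queryString (greedy (fun a => queryString a cs b C ∈ O) (t + k)) cs b C,
        s1, s2, s3, s4, s5, [], [], List.replicate k true ++ s8, s9, s10, s11] := by
  induction k generalizing t s8 with
  | zero => exact den_drain_nil rfl
  | succ k ih =>
    rw [den_drain_cons (b := true) (v := List.replicate k true) (by simp)
      (by simp [List.replicate_succ]), Bool.cond_self]
    simp only [List.set]
    rw [den_extendPrefix, show t + (k + 1) = (t + 1) + k by lia, List.replicate_succ',
      List.append_assoc, List.singleton_append, ← ih]
    rfl

theorem den_extendAll (C : List Bool) (cs : List (Bool × Bool)) (b : Bool) (k : ℕ)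
    (s1 s2 s3 s4 s5 s9 s10 s11 : List Bool) :
    den O extendAll
      (st [queryString [] cs b C,
        s1, s2, s3, s4, s5, List.replicate k true, [], [], s9, s10, s11]) =
      st [queryString (greedy (fun a => queryString a cs b C ∈ O) k) cs b C,
        s1, s2, s3, s4, s5, List.replicate k true, [], [], s9, s10, s11] := by
  have := den_extendAll_drain (O := O) C cs b 0 k s1 s2 s3 s4 s5 [] s9 s10 s11
  rw [greedy, Nat.zero_add] at this
  rw [extendAll, den_seq, this, den_moveAll _ _ _ (by simp) (by simp) (by simp)]
  simp

/-- An exhausted `a` counts as agreement with the input, so a round without a block restores the set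
unchanged. -/
theorem den_readOnes_readBack (cs : List (Bool × Bool))
    (a rest s1 s2 s3 s4 s5 s6 s7 s8 s11 : List Bool) :
    den O (readOnes 10 readBack)
      (st [encodeInputs cs ++ false :: rest, s1, s2, s3, s4, s5, s6, s7, s8, a, [true], s11]) =
      st [rest, s1, ((updateInputs cs a).map Prod.snd).reverse ++ s2,
        ((updateInputs cs a).map Prod.fst).reverse ++ s3, s4, s5, s6, s7, s8,
        a.drop cs.length, [], s11] := by
  induction cs generalizing a s2 s3 with
  | nil =>
    rw [den_readOnes_false (v := rest) (f := []) (b := true) (by simp [encodeInputs]) (by simp)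
      (by simp) (by simp), den_readOnes_nil (by simp)]
    simp [updateInputs]
  | cons c cs ih =>
    obtain ⟨u, x⟩ := c
    rw [den_readOnes_true (v := u :: x :: (encodeInputs cs ++ false :: rest)) (b := true) (f := [])
      (by simp [encodeInputs]) (by simp) (by simp)]
    have h := ih a.tail (x :: s2) ((u || !(a.headD true)) :: s3)
    have hb : den O readBack (st [u :: x :: (encodeInputs cs ++ false :: rest), s1, s2, s3, s4, s5,
        s6, s7, s8, a, [true], s11]) = st [encodeInputs cs ++ false :: rest, s1, x :: s2,
        (u || !(a.headD true)) :: s3, s4, s5, s6, s7, s8, a.tail, [true], s11] := by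
      rcases a with _ | ⟨_ | _, a⟩ <;>
        simp [readBack, den_seq, den_branch, den_pop, den_push, den_move]
    simp only [List.set]
    rw [hb, h]
    simp [updateInputs]

theorem den_round (b : Bool) (C : List Bool) (cs : List (Bool × Bool)) (k : ℕ) :
    den O (round b) (roundStore C cs k cs.length) =
      roundStore C (updateInputs cs
        (greedyOrNil (fun a => queryString a cs b C ∈ O) cs.length)) k cs.length := by
  set a := greedyOrNil (fun a => queryString a cs b C ∈ O) cs.length with ha
  have hq : den O (.branch 7 .skip (.pop 7) (.seq (.pop 7) extendAll)) (den O (.query 0 7)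
      (den O (build b) (roundStore C cs k cs.length))) =
      st [queryString a cs b C, [], [], [], List.replicate k true, [],
        List.replicate cs.length true, [], [], [], [], []] := by
    rw [den_build, den_query _ _ _ (by simp), den_branch]
    by_cases h : queryString [] cs b C ∈ O
    · simp [h, den_seq, den_pop, den_extendAll, ha, greedyOrNil]
    · simp [h, den_pop, ha, greedyOrNil]
  -- No more bits than coordinates were found, so stack 9 is empty again, as `roundStore` demands.
  have hl : a.drop cs.length = [] := List.drop_eq_nil_of_le (length_greedyOrNil_le _ _)
  simp only [round, den_seq]
  rw [hq, queryString, den_scan_prefix, scan, den_seq, den_push _ _ _ (by simp)]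
  simp only [List.set, List.getD_cons_succ, List.getD_cons_zero, List.append_nil,
    List.reverse_reverse]
  -- The last pop removes the target bit, leaving the bare circuit on stack 0.
  rw [den_readOnes_readBack, hl, den_pop _ _ (by simp)]
  simp [roundStore]

end Certification

namespace Certification

/-! ### Certificates from locally minimal sensitive blocks -/

variable {n : ℕ} {f : (Fin n → Bool) → Bool} {x : Fin n → Bool} {b : Bool} {U : Finset (Fin n)}

theorem isCertificate_mono {S T : Finset (Fin n)} (h : IsCertificate f x S) (hST : S ⊆ T) :
    IsCertificate f x T := fun y hy => h y fun i hi => hy i (hST hi)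

theorem exists_isCertificate_card_eq (f : (Fin n → Bool) → Bool) (x : Fin n → Bool) :
    ∃ S : Finset (Fin n), IsCertificate f x S ∧ S.card = certAt f x :=
  Nat.sInf_mem (s := {k | ∃ S : Finset (Fin n), IsCertificate f x S ∧ S.card = k})
    ⟨_, Finset.univ, fun y hy => by rw [funext fun i => hy i (Finset.mem_univ i)], rfl⟩

theorem certAt_le_certComplexity (f : (Fin n → Bool) → Bool) (x : Fin n → Bool) :
    certAt f x ≤ certComplexity f := Finset.le_sup (Finset.mem_univ x)

/-- Some `y` with `f y = b` agrees with `x` where `a` is `1`, differs from `x` where `a` is `0`, and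
agrees with `x` at those elements of `U` for which `a` has no bit. -/
def Extends (f : (Fin n → Bool) → Bool) (x : Fin n → Bool) (b : Bool) (U : Finset (Fin n))
    (a : List Bool) : Prop :=
  ∃ y, f y = b ∧ ∀ i : Fin n, (a[(i : ℕ)]? = some true → y i = x i) ∧
    (a[(i : ℕ)]? = some false → y i = !x i) ∧ (a[(i : ℕ)]? = none → i ∈ U → y i = x i)

/-- The positions of the bits `0`. -/
def block (n : ℕ) (a : List Bool) : Finset (Fin n) :=
  Finset.univ.filter fun i => a[(i : ℕ)]? = some false

theorem mem_block {a : List Bool} {i : Fin n} : i ∈ block n a ↔ a[(i : ℕ)]? = some false := by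
  simp [block]

theorem isCertificate_of_not_extends (h : ¬ Extends f x (!f x) U []) : IsCertificate f x U := by
  intro y hy
  by_contra hne
  exact h ⟨y, by cases h : f x <;> cases h' : f y <;> simp_all, fun i => by simpa using hy i⟩

theorem getElem?_greedy_of_lt {q : List Bool → Prop} {i t t' : ℕ} (hi : i < t) (ht : t ≤ t') :
    (greedy q t')[i]? = (greedy q t)[i]? := by
  induction t', ht using Nat.le_induction with
  | base => rfl
  | succ t' ht ih =>
    rw [greedy, List.getElem?_append_left (by rw [length_greedy]; lia), ih]

theorem getElem?_greedy_succ_self (q : List Bool → Prop) (t : ℕ) :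
    (greedy q (t + 1))[t]? =
      some (@decide (q (greedy q t ++ [true])) (Classical.propDecidable _)) := by
  rw [greedy, List.getElem?_append_right (by rw [length_greedy])]
  simp [length_greedy]

/-- Invariant of the greedy search: the prefix always has a completion with value `b`, and no
coordinate of `U` is ever flipped, since the current completion agrees with `x` there. -/
theorem extends_greedy (h : Extends f x b U []) {t : ℕ} (ht : t ≤ n) :
    Extends f x b U (greedy (Extends f x b U) t) ∧
      ∀ i ∈ U, (i : ℕ) < t → (greedy (Extends f x b U) t)[(i : ℕ)]? = some true := by
  induction t with
  | zero => exact ⟨h, fun i _ hi => absurd hi (Nat.not_lt_zero _)⟩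
  | succ t ih =>
    obtain ⟨hE, hU⟩ := ih (by lia)
    set a := greedy (Extends f x b U) t with ha
    have hlen : a.length = t := length_greedy _ _
    -- A completion of the prefix also completes its extension by the bit that tells whether it
    -- agrees with `x` at position `t`.
    have key : ∀ y, f y = b → (∀ i : Fin n, (a[(i : ℕ)]? = some true → y i = x i) ∧
        (a[(i : ℕ)]? = some false → y i = !x i) ∧ (a[(i : ℕ)]? = none → i ∈ U → y i = x i)) →
        Extends f x b U (a ++ [y ⟨t, ht⟩ == x ⟨t, ht⟩]) := by
      intro y hy hya
      refine ⟨y, hy, fun i => ?_⟩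
      rcases lt_trichotomy (i : ℕ) t with hi | hi | hi
      · rw [List.getElem?_append_left (by lia)]
        exact hya i
      · have : i = ⟨t, ht⟩ := Fin.ext hi
        subst this
        simp only [List.getElem?_append_right hlen.le, hlen]
        cases y ⟨t, ht⟩ <;> cases x ⟨t, ht⟩ <;> simp
      · have h1 : (a ++ [y ⟨t, ht⟩ == x ⟨t, ht⟩])[(i : ℕ)]? = none :=
          List.getElem?_eq_none (by simp [hlen]; lia)
        have h2 : a[(i : ℕ)]? = none := List.getElem?_eq_none (by lia)
        rw [h1]
        rw [← h2]
        simpa [h2] using (hya i).2.2 h2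
    have hnone : ∀ i : Fin n, (i : ℕ) = t → a[(i : ℕ)]? = none := fun i hi =>
      List.getElem?_eq_none (by lia)
    by_cases hq : Extends f x b U (a ++ [true])
    · have hg : greedy (Extends f x b U) (t + 1) = a ++ [true] := by
        rw [greedy, ← ha]; simp [hq]
      rw [hg]
      refine ⟨hq, fun i hi hit => ?_⟩
      rcases Nat.lt_succ_iff_lt_or_eq.1 hit with hit | hit
      · rw [List.getElem?_append_left (by lia)]
        exact hU i hi hit
      · rw [List.getElem?_append_right (by lia), hit, hlen]
        simp
    · have hg : greedy (Extends f x b U) (t + 1) = a ++ [false] := by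
        rw [greedy, ← ha]; simp [hq]
      rw [hg]
      obtain ⟨y, hy, hya⟩ := hE
      have hk := key y hy hya
      -- The oracle refused the bit `1`, so the completion must differ from `x` at `t`.
      have hne : (y ⟨t, ht⟩ == x ⟨t, ht⟩) = false := by
        by_contra hc
        rw [Bool.not_eq_false] at hc
        exact hq (hc ▸ hk)
      refine ⟨hne ▸ hk, fun i hi hit => ?_⟩
      rcases Nat.lt_succ_iff_lt_or_eq.1 hit with hit | hit
      · rw [List.getElem?_append_left (by lia)]
        exact hU i hi hit
      · have : i = ⟨t, ht⟩ := Fin.ext hit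
        subst this
        rw [(hya _).2.2 (hnone _ rfl) hi] at hne
        simp at hne

/-- The set after one round with target `b`. -/
noncomputable def nextSet (f : (Fin n → Bool) → Bool) (x : Fin n → Bool) (b : Bool)
    (U : Finset (Fin n)) : Finset (Fin n) :=
  U ∪ block n (greedyOrNil (Extends f x b U) n)

/-- The point `x` itself answers every query positively, so nothing is flipped. -/
theorem nextSet_self : nextSet f x (f x) U = U := by
  have h : ∀ k, Extends f x (f x) U (List.replicate k true) := fun k =>
    ⟨x, rfl, fun i => by simp [List.getElem?_replicate]⟩
  have hg : ∀ t, greedy (Extends f x (f x) U) t = List.replicate t true := by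
    intro t
    induction t with
    | zero => rfl
    | succ t ih =>
      have := h (t + 1)
      rw [List.replicate_succ'] at this
      rw [greedy, ih, List.replicate_succ']
      simp [this]
  rw [nextSet, greedyOrNil, if_pos (show Extends f x (f x) U [] from h 0), hg, Finset.union_eq_left]
  intro i hi
  simp [mem_block] at hi

theorem block_nil : block n [] = ∅ := by ext; simp [mem_block]

/-- A block found in a round is disjoint from the set, it meets every certificate, and its size is at
most the certificate complexity. -/
theorem block_greedy_spec (h : Extends f x (!f x) U []) :
    Disjoint U (block n (greedy (Extends f x (!f x) U) n)) ∧
    (∀ S, IsCertificate f x S → (block n (greedy (Extends f x (!f x) U) n) ∩ S).Nonempty) ∧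
    (block n (greedy (Extends f x (!f x) U) n)).card ≤ certComplexity f := by
  obtain ⟨⟨z, hz, hza⟩, hU⟩ := extends_greedy h le_rfl
  set q := Extends f x (!f x) U with hqdef
  have hsome : ∀ i : Fin n, (greedy q n)[(i : ℕ)]? ≠ none := by
    intro i hi
    rw [List.getElem?_eq_none_iff, length_greedy] at hi
    lia
  have heq : ∀ i, i ∉ block n (greedy q n) → z i = x i := by
    intro i hi
    rw [mem_block] at hi
    refine (hza i).1 ?_
    rcases hc : (greedy q n)[(i : ℕ)]? with _ | _ | _
    · exact absurd hc (hsome i)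
    · exact absurd hc hi
    · rfl
  have hdisj : Disjoint U (block n (greedy q n)) := by
    rw [Finset.disjoint_left]
    intro i hi hib
    rw [mem_block, hU i hi i.2] at hib
    simp at hib
  refine ⟨hdisj, fun S hS => ?_, ?_⟩
  -- A certificate disjoint from the block would force `f z = f x`, as `z` agrees with `x` off the
  -- block.
  · by_contra hne
    rw [Finset.not_nonempty_iff_eq_empty] at hne
    have := hS z fun i hi => heq i fun hib => by
      have : i ∈ block n (greedy q n) ∩ S := Finset.mem_inter.2 ⟨hib, hi⟩
      simp [hne] at this
    rw [hz] at this
    simp at this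
  -- A smallest certificate at `z`, not at `x`, contains the block. If it missed some `i`, restoring
  -- `z` at `i` would keep the value, and the restored point would justify the bit `1` at step `i`.
  · obtain ⟨S, hS, hcard⟩ := exists_isCertificate_card_eq f z
    refine le_trans (Finset.card_le_card fun i hi => ?_)
      (hcard.le.trans (certAt_le_certComplexity f z))
    by_contra hiS
    have hy := hS (Function.update z i (x i)) fun j hj =>
      Function.update_of_ne (ne_of_mem_of_not_mem hj hiS) _ _
    have hno : ¬ q (greedy q i ++ [true]) := by
      have h1 := mem_block.1 hi
      rw [getElem?_greedy_of_lt (Nat.lt_succ_self _) i.2, getElem?_greedy_succ_self] at h1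
      simpa using h1
    refine hno ⟨_, by rw [← hy, hz], fun j => ?_⟩
    have hl : (greedy q i).length = i := length_greedy _ _
    rcases lt_trichotomy (j : ℕ) i with hj | hj | hj
    · rw [List.getElem?_append_left (by lia), ← getElem?_greedy_of_lt hj i.2.le,
        Function.update_of_ne (by intro h; rw [h] at hj; exact lt_irrefl _ hj)]
      exact ⟨(hza j).1, (hza j).2.1, fun h => absurd h (hsome j)⟩
    · have : j = i := Fin.ext hj
      subst this
      rw [List.getElem?_append_right hl.le, hl]
      simp
    -- Beyond `i` only the coordinates of `U` are constrained, and these lie outside the block.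
    · have h1 : (greedy q i ++ [true])[(j : ℕ)]? = none :=
        List.getElem?_eq_none (by simp [hl]; lia)
      rw [h1, Function.update_of_ne (by intro h; rw [h] at hj; exact lt_irrefl _ hj)]
      exact ⟨by simp, by simp, fun _ hjU => heq j (Finset.disjoint_left.1 hdisj hjU)⟩

theorem nextSet_of_extends (h : Extends f x b U []) :
    nextSet f x b U = U ∪ block n (greedy (Extends f x b U) n) := by
  rw [nextSet, greedyOrNil, if_pos h]

theorem nextSet_of_not_extends (h : ¬ Extends f x b U []) : nextSet f x b U = U := by
  rw [nextSet, greedyOrNil, if_neg h, block_nil, Finset.union_empty]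

/-- A new block has at most `certComplexity f` elements, and at least one of them is a new element
of `S`. -/
theorem nextSet_card_le {S : Finset (Fin n)} (hS : IsCertificate f x S)
    (h : U.card ≤ certComplexity f * (U ∩ S).card) :
    (nextSet f x (!f x) U).card ≤ certComplexity f * (nextSet f x (!f x) U ∩ S).card := by
  by_cases hE : Extends f x (!f x) U []
  · obtain ⟨hd, hm, hc⟩ := block_greedy_spec hE
    rw [nextSet_of_extends hE, Finset.card_union_of_disjoint hd, Finset.union_inter_distrib_right,
      Finset.card_union_of_disjoint (hd.mono Finset.inter_subset_left Finset.inter_subset_left),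
      Nat.mul_add]
    exact Nat.add_le_add h (hc.trans (Nat.le_mul_of_pos_right _ (Finset.card_pos.2 (hm S hS))))
  · rwa [nextSet_of_not_extends hE]

/-- Progress: a block meets some certificate, hence is nonempty, and it is disjoint from `U`. -/
theorem isCertificate_nextSet_or {t : ℕ} (h : IsCertificate f x U ∨ t ≤ U.card) :
    IsCertificate f x (nextSet f x (!f x) U) ∨ t + 1 ≤ (nextSet f x (!f x) U).card := by
  by_cases hE : Extends f x (!f x) U []
  · rcases h with h | h
    · exact .inl (isCertificate_mono h Finset.subset_union_left)
    · obtain ⟨S, hS, -⟩ := exists_isCertificate_card_eq f x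
      obtain ⟨hd, hm, -⟩ := block_greedy_spec hE
      have := Finset.card_pos.2 ((hm S hS).mono Finset.inter_subset_left)
      rw [nextSet_of_extends hE, Finset.card_union_of_disjoint hd]
      exact .inr (by lia)
  · rw [nextSet_of_not_extends hE]
    exact .inl (isCertificate_of_not_extends hE)

/-- The set found by the algorithm. -/
noncomputable def certSet (f : (Fin n → Bool) → Bool) (x : Fin n → Bool) (t : ℕ) :
    Finset (Fin n) :=
  (fun U => nextSet f x false (nextSet f x true U))^[t] ∅

theorem certSet_succ (f : (Fin n → Bool) → Bool) (x : Fin n → Bool) (t : ℕ) :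
    certSet f x (t + 1) = nextSet f x (!f x) (certSet f x t) := by
  rw [certSet, Function.iterate_succ_apply', ← certSet]
  have hs : ∀ U, nextSet f x (f x) U = U := fun _ => nextSet_self
  cases h : f x with
  | false => rw [h] at hs; simp [hs]
  | true => rw [h] at hs; simp [hs]

theorem isCertificate_certSet (f : (Fin n → Bool) → Bool) (x : Fin n → Bool) :
    IsCertificate f x (certSet f x n) := by
  have h : ∀ t, IsCertificate f x (certSet f x t) ∨ t ≤ (certSet f x t).card := by
    intro t
    induction t with
    | zero => exact .inr (Nat.zero_le _)
    | succ t ih => rw [certSet_succ]; exact isCertificate_nextSet_or ih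
  rcases h n with h | h
  · exact h
  -- Growth in each of the `n` rounds exhausts all coordinates.
  · have : certSet f x n = Finset.univ := by
      rw [← Finset.card_eq_iff_eq_univ, Fintype.card_fin]
      exact le_antisymm (by simpa using Finset.card_le_univ (certSet f x n)) h
    intro y hy
    rw [funext fun i => hy i (this ▸ Finset.mem_univ i)]

theorem card_certSet_le (f : (Fin n → Bool) → Bool) (x : Fin n → Bool) (t : ℕ) :
    (certSet f x t).card ≤ certComplexity f ^ 2 := by
  obtain ⟨S, hS, hcard⟩ := exists_isCertificate_card_eq f x
  have h : (certSet f x t).card ≤ certComplexity f * (certSet f x t ∩ S).card := by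
    induction t with
    | zero => simp [certSet]
    | succ t ih => rw [certSet_succ]; exact nextSet_card_le hS ih
  rw [pow_two]
  exact h.trans (Nat.mul_le_mul_left _ ((Finset.card_le_card Finset.inter_subset_right).trans
    (hcard.le.trans (certAt_le_certComplexity f x))))

end Certification

namespace Certification

/-! ### Correctness and running time of the algorithm -/

variable {n : ℕ}
/-- The coordinates of a point, with the characteristic function of a set. -/
def coords (x : Fin n → Bool) (U : Finset (Fin n)) : List (Bool × Bool) :=
  List.ofFn fun i => (decide (i ∈ U), x i)

theorem length_coords (x : Fin n → Bool) (U : Finset (Fin n)) : (coords x U).length = n := by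
  simp [coords]

theorem assignment_coords (x : Fin n → Bool) (U : Finset (Fin n)) (a w : List Bool) :
    assignment (coords x U) a w = List.ofFn fun i : Fin n => match a[(i : ℕ)]? with
      | none => if i ∈ U then x i else w.getD i false
      | some v => if v then x i else !x i := by
  apply List.ext_getElem? fun i => ?_
  rw [getElem?_assignment, coords, List.getElem?_ofFn, List.getElem?_ofFn]
  by_cases h : i < n <;> simp [h]

/-- The number of inputs is written in unary, so a full assignment fits the length bound on
witnesses in `oracle`. -/
theorem length_le_length_queryString (C : Circuit n) (a : List Bool) (cs : List (Bool × Bool))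
    (b : Bool) : n ≤ (queryString a cs b C.encode).length := by
  simp [queryString, Circuit.encode, encodeNat]
  lia

/-- The completion itself is the witness; conversely, a witness that is too short is padded by
`false`. -/
theorem queryString_coords_mem_oracle (C : Circuit n) (x : Fin n → Bool) (U : Finset (Fin n))
    (b : Bool) (a : List Bool) :
    queryString a (coords x U) b C.encode ∈ oracle ↔ Extends C.eval x b U a := by
  rw [queryString_mem_oracle]
  constructor
  · rintro ⟨w, -, hw⟩
    rw [assignment_coords] at hw
    refine ⟨_, hw, fun i => ⟨fun h => ?_, fun h => ?_, fun h hi => ?_⟩⟩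
    · simp [h]
    · simp [h]
    · simp [h, hi]
  · rintro ⟨y, hy, h⟩
    refine ⟨List.ofFn y, by simpa using length_le_length_queryString C a (coords x U) b, ?_⟩
    have : assignment (coords x U) a (List.ofFn y) = List.ofFn y := by
      rw [assignment_coords]
      congr 1
      funext i
      obtain ⟨h1, h2, h3⟩ := h i
      rcases hc : a[(i : ℕ)]? with _ | _ | _
      · by_cases hi : i ∈ U
        · simp [hi, h3 hc hi]
        · simp [hi]
      · simp [h2 hc]
      · simp [h1 hc]
    rw [this]
    exact hy

theorem getElem?_updateInputs (cs : List (Bool × Bool)) (a : List Bool) (i : ℕ) :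
    (updateInputs cs a)[i]? = cs[i]?.map fun c => (c.1 || !(a.getD i true), c.2) := by
  induction cs generalizing a i with
  | nil => simp [updateInputs]
  | cons c cs ih =>
    obtain ⟨u, x⟩ := c
    rcases i with _ | i <;> rcases a with _ | ⟨v, a⟩ <;> simp [updateInputs, ih]

theorem updateInputs_coords (x : Fin n → Bool) (U : Finset (Fin n)) (a : List Bool) :
    updateInputs (coords x U) a = coords x (U ∪ block n a) := by
  apply List.ext_getElem? fun i => ?_
  rw [getElem?_updateInputs, coords, coords, List.getElem?_ofFn, List.getElem?_ofFn]
  split_ifs with h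
  · rcases hc : a[i]? with _ | _ | _ <;> simp [mem_block, hc]
  · simp

theorem den_round_coords (C : Circuit n) (x : Fin n → Bool) (U : Finset (Fin n)) (b : Bool)
    (k : ℕ) : den oracle (round b) (roundStore C.encode (coords x U) k n) =
      roundStore C.encode (coords x (nextSet C.eval x b U)) k n := by
  have := den_round (O := oracle) b C.encode (coords x U) k
  simp only [length_coords, queryString_coords_mem_oracle, updateInputs_coords] at this
  exact this

theorem size_roundStore (C : List Bool) (x : Fin n → Bool) (U : Finset (Fin n)) (k : ℕ) :
    size (roundStore C (coords x U) k n) = C.length + 3 * n + k := by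
  rw [roundStore, size_st]
  simp [length_coords]
  lia

/-- The body is only `PolyTime`, so the general loop rule does not apply. Instead, the size of a
`roundStore` does not depend on the set, and one bound `M` covers all rounds. -/
theorem exec_rounds : ∃ T : Polynomial ℕ, ∀ (n : ℕ) (C : Circuit n) (x : Fin n → Bool)
    (k : ℕ) (U : Finset (Fin n)) (M : ℕ), C.encode.length + 3 * n + k ≤ M →
    ∃ t ≤ k * (T.eval M + 1) + 1,
      Exec oracle rounds (roundStore C.encode (coords x U) k n)
        (roundStore C.encode (coords x
          ((fun U => nextSet C.eval x false (nextSet C.eval x true U))^[k] U)) 0 n) t := by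
  obtain ⟨T, G, h⟩ := ((tame_pop (O := oracle) (r := 4) (by simp)).polyTime.seq
    ((polyTime_round true).seq (polyTime_round false)))
  refine ⟨T, fun n C x k => ?_⟩
  induction k with
  | zero => exact fun U M _ => ⟨1, by lia, .loop_nil (by simp [roundStore, st])⟩
  | succ k ih =>
    intro U M hM
    obtain ⟨-, t, ht, he⟩ := h (roundStore C.encode (coords x U) (k + 1) n)
    obtain ⟨t', ht', he'⟩ := ih (nextSet C.eval x false (nextSet C.eval x true U)) M (by lia)
    have hp : den oracle (.pop 4) (roundStore C.encode (coords x U) (k + 1) n) =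
        roundStore C.encode (coords x U) k n := by
      rw [roundStore, den_pop _ _ (by simp)]
      simp [roundStore, List.replicate_succ]
    rw [den_seq, den_seq, hp, den_round_coords, den_round_coords] at he
    rw [size_roundStore] at ht
    have hT := eval_mono T hM
    refine ⟨t + t' + 1, ?_, .loop_cons (by simp [roundStore, st, List.replicate_succ]) he he'⟩
    rw [Nat.add_mul]
    lia

/-! ### Length of the input and total running time. -/

theorem length_encode_gate_le {m : ℕ} {g : Gate} (h : g.ArgsLt m) :
    g.encode.length ≤ 2 * m + 4 := by
  rcases g with b | i | ⟨i, j⟩ | ⟨i, j⟩ <;>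
    simp only [Gate.ArgsLt] at h <;> simp [Gate.encode, encodeNat] <;> lia

theorem length_encode_le (C : Circuit n) : C.encode.length ≤
    (n + C.size) * (2 * (n + C.size) + 5) + 2 * (n + C.size) + 3 := by
  have hg : ∀ g ∈ C.gates, (true :: g.encode).length ≤ 2 * (n + C.size) + 5 := by
    intro g hg
    obtain ⟨k, hk, rfl⟩ := List.mem_iff_getElem.1 hg
    have h1 := length_encode_gate_le (C.argsLt k hk)
    have h2 : k < C.size := hk
    rw [List.length_cons]
    lia
  have hf : (C.gates.flatMap fun g => true :: g.encode).length ≤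
      C.size * (2 * (n + C.size) + 5) := by
    rw [List.length_flatMap]
    refine (List.sum_le_card_nsmul _ (2 * (n + C.size) + 5) ?_).trans (by simp [Circuit.size])
    simpa using hg
  have ho : C.out < n + C.size := C.outLt
  simp only [Circuit.encode, List.length_append, encodeNat, List.length_replicate, List.length_cons,
    List.length_nil]
  have : C.size * (2 * (n + C.size) + 5) ≤ (n + C.size) * (2 * (n + C.size) + 5) :=
    Nat.mul_le_mul_right _ (by lia)
  lia

theorem exec_certify : ∃ p : Polynomial ℕ, ∀ (n : ℕ) (C : Circuit n) (x : Fin n → Bool),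
    ∃ t ≤ p.eval (n + C.size), ∃ σ, σ 0 = encodeSet (certSet C.eval x n) ∧
      Exec oracle certify (inputStore C.encode (List.ofFn x)) σ t := by
  obtain ⟨T₁, G₁, h₁⟩ := polyTime_prepare (O := oracle)
  obtain ⟨T₂, h₂⟩ := exec_rounds
  obtain ⟨T₃, G₃, h₃⟩ := (polyTime_drain (O := oracle) (r := 0) (by simp) tame_skip tame_skip
    trivial trivial).seq (tame_moveAll (r := 3) (s := 0) (by simp) (by simp) (by simp)).polyTime
  -- Bounds the circuit encoding plus `4 * n`: three stacks of length `n` and the round counter.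
  let E : Polynomial ℕ := .X * (2 * .X + 5) + 2 * .X + 3 + 4 * .X
  refine ⟨T₁.comp E + .X * (T₂.comp E + 1) + T₃.comp E + 3, fun n C x => ?_⟩
  have hE : C.encode.length + 4 * n ≤ E.eval (n + C.size) := by
    have := length_encode_le C
    simp only [E, Polynomial.eval_add, Polynomial.eval_mul, Polynomial.eval_X,
      Polynomial.eval_ofNat]
    lia
  obtain ⟨-, t₁, ht₁, he₁⟩ := h₁ (inputStore C.encode (List.ofFn x))
  obtain ⟨t₂, ht₂, he₂⟩ := h₂ n C x n ∅ (E.eval (n + C.size)) (by lia)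
  rw [← certSet] at he₂
  obtain ⟨-, t₃, ht₃, he₃⟩ := h₃ (roundStore C.encode (coords x (certSet C.eval x n)) 0 n)
  have hp : den oracle prepare (inputStore C.encode (List.ofFn x)) =
      roundStore C.encode (coords x ∅) n n := by
    have := den_prepare (O := oracle) C.encode (List.ofFn x) [] [] [] []
    rw [inputStore_eq_st, this]
    simp [roundStore, coords, List.map_ofFn, Function.comp_def, List.ofFn_const]
  have hs : size (inputStore C.encode (List.ofFn x)) ≤ E.eval (n + C.size) := by
    rw [size_inputStore, List.length_ofFn]; lia
  have hs' : size (roundStore C.encode (coords x (certSet C.eval x n)) 0 n) ≤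
      E.eval (n + C.size) := by
    rw [size_roundStore]; lia
  rw [hp] at he₁
  have := eval_mono T₁ hs
  have := eval_mono T₃ hs'
  have hm : n * (T₂.eval (E.eval (n + C.size)) + 1) ≤
      (n + C.size) * (T₂.eval (E.eval (n + C.size)) + 1) := Nat.mul_le_mul_right _ (by lia)
  refine ⟨_, ?_, _, ?_, he₁.seq (he₂.seq he₃)⟩
  · simp only [Polynomial.eval_add, Polynomial.eval_mul, Polynomial.eval_comp, Polynomial.eval_X,
      Polynomial.eval_one, Polynomial.eval_ofNat]
    lia
  -- Stack 3 holds the set in reverse order, and the final `moveAll` puts it right.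
  · rw [roundStore, den_seq, den_drain_skip, den_moveAll _ _ _ (by simp) (by simp) (by simp)]
    simp [st, coords, encodeSet, List.map_ofFn, Function.comp_def]

end Certification

theorem theorem1 :
    ∃ L : Language Bool, InNP L ∧
      ∃ (P : Prog) (p : Polynomial ℕ) (K : ℕ) (ε : ℕ → ℝ),
        Asymptotics.SuperpolynomialDecay Filter.atTop (fun n : ℕ => (n : ℝ)) ε ∧
        ∀ (n : ℕ) (C : Circuit n) (x : Fin n → Bool),
          HaltsWithin L P C.encode (List.ofFn x) (p.eval (n + C.size)) ∧
          1 - ε n ≤ outputProb L P C.encode (List.ofFn x) (p.eval (n + C.size))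
            {w | ∃ S : Finset (Fin n), w = encodeSet S ∧ IsCertificate C.eval x S ∧
              S.card ≤ K * certComplexity C.eval ^ 5} := by
  obtain ⟨p, hp⟩ := Certification.exec_certify
  -- No coins are tossed, so the error is `0`; the constant is `1`.
  refine ⟨Certification.oracle, Certification.inNP_oracle, Certification.certify, p, 1, 0,
    Asymptotics.superpolynomialDecay_zero _ _, fun n C x => ?_⟩
  obtain ⟨t, ht, σ, hσ, he⟩ := hp n C x
  have hrun : ∀ coins : List Bool, coins.length = p.eval (n + C.size) →
      run Certification.oracle Certification.certify (inputStore C.encode (List.ofFn x)) coins =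
        ⟨[], σ⟩ := fun coins hc => he.run_eq (hc ▸ ht)
  have hcard : (Certification.certSet C.eval x n).card ≤ 1 * certComplexity C.eval ^ 5 := by
    refine (Certification.card_certSet_le C.eval x n).trans ?_
    rw [one_mul]
    -- Raising the exponent from 2 to 5 needs a positive base; at `0` both powers vanish.
    rcases Nat.eq_zero_or_pos (certComplexity C.eval) with h | h
    · simp [h]
    · exact Nat.pow_le_pow_right h (by simp)
  refine ⟨fun coins hc => by rw [hrun coins hc], ?_⟩
  have hall : ∀ r : Fin (p.eval (n + C.size)) → Bool,
      (run Certification.oracle Certification.certify (inputStore C.encode (List.ofFn x))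
        (List.ofFn r)).todo = [] ∧
      (run Certification.oracle Certification.certify (inputStore C.encode (List.ofFn x))
        (List.ofFn r)).store 0 ∈ {w | ∃ S : Finset (Fin n), w = encodeSet S ∧
          IsCertificate C.eval x S ∧ S.card ≤ 1 * certComplexity C.eval ^ 5} := by
    intro r
    rw [hrun _ List.length_ofFn]
    exact ⟨rfl, _, hσ, Certification.isCertificate_certSet C.eval x, hcard⟩
  -- Every coin sequence is good, so the count is `2 ^ T` and the probability is 1.
  rw [outputProb, Nat.card_congr (Equiv.subtypeUnivEquiv hall)]
  simp
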